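/- **Setup.** Let $V$ be a finite-dimensional complex vector space and let $R\subset V^*$ be an irreducible reduced crystallographic root system with coroots $\alpha^\vee\in V$ (for instance $R\subset\mathbb R^n\subset V=\mathbb C^n$, where $V^*$ is identified with $V$ by the standard bilinear form); write $(\alpha,x)=\alpha(x)$. Let $W$ be the Weyl group, $\Delta=\{\alpha_1,\dots,\alpha_n\}$ a set of simple roots, $R_+$ the positive roots, $\theta$ the maximal root, $Q^\vee$, $P^\vee\subset V$ and $P\subset V^*$ the coroot, coweight and weight lattices. Let $\hbar\in\mathbb C\setminus\pi i\mathbb Q$, and write $[\alpha,c]$ for the affine functional $x\mapsto(\alpha,x)+c$. Put $\widehat R=\{[\alpha,\hbar k]\mid \alpha\in R,\ k\in\mathbb Z\}$, $\alpha_0=[-\theta,\hbar]$, and $s_\beta(x)=x-\beta(x)\alpha^\vee$ for $\beta=[\alpha,\hbar k]\in\widehat R$, $s_i=s_{\alpha_i}$ for $0\le i\le n$. The group $\widehat W=W\ltimes\tau(P^\vee)$, with $\tau(\lambda)x=x+\hbar\lambda$, acts on $V$ and on affine functionals by $w(\varphi)=\varphi\circ w^{-1}$; let $\Pi=\{\pi_r\}\subset\widehat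 W$ be the subgroup preserving $\{\alpha_0,\dots,\alpha_n\}$. Fix a non-zero integer $\epsilon_0$ with $(P,P^\vee)\subset\epsilon_0^{-1}\mathbb Z$ and put $\widehat P=\{[\mu,\hbar m/\epsilon_0]\mid \mu\in P,\ m\in\mathbb Z\}$. Let $t\colon\widehat R\to\mathbb C\setminus\{0\}$ be $\widehat W$-invariant, $t_i=t_{\alpha_i}$. **The algebra and its representation.** The double affine Hecke algebra $\mathbb H_t$ of type $\widehat R$ is generated by $T_0,\dots,T_n$, by $X^\mu$ ($\mu\in\widehat P$) and by the group $\Pi$, with the relations $X^\mu X^{\mu'}=X^{\mu+\mu'}$; $X^{[0,c]}=e^{c}$; $(T_i-t_i)(T_i+t_i^{-1})=0$; $T_iT_jT_i\cdots=T_jT_iT_j\cdots$ ($m_{ij}$ factors) if $i\ne j$ and the order $m_{ij}$ of $s_is_j$ is finite; $\pi_rT_i\pi_r^{-1}=T_j$ if $\pi_r(\alpha_i)=\alpha_j$; $T_i^{-1}X^\mu T_i^{-1}=X^{\mu-\alpha_i}$ if $(\mu,\alpha_i^\vee)=1$; $T_iX^\mu=X^\mu T_i$ if $(\mu,\alpha_i^\vee)=0$;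 $\pi_rX^\mu\pi_r^{-1}=X^{\pi_r(\mu)}$. Let $\mathcal F$ be the algebra of smooth functions $f\colon V\to\mathbb C$ in the complex sense (infinitely complex differentiable, i.e. entire) with $f(x+2\pi i\alpha^\vee)=f(x)$ for all $\alpha\in R$. In the polynomial representation $\mathbb H_t$ acts on $\mathcal F$ by $$X^\mu=e^{\mu(x)},\qquad (\pi_rf)(x)=f(\pi_r^{-1}x),\qquad T_i=\frac{t_i-t_i^{-1}}{1-e^{-\alpha_i(x)}}+\frac{t_i^{-1}-t_ie^{-\alpha_i(x)}}{1-e^{-\alpha_i(x)}}\,s_i,$$ where $T_if$ is extended holomorphically across the hyperplanes $e^{-\alpha_i(x)}=1$. **The ideal.** Let $\eta\colon R\to\mathbb C$ be $W$-invariant and $S_0\subset\Delta$. For $S\subset R$ put $H_\eta(S)=\{x\in V\mid(\alpha,x)=\eta_\alpha\ \forall\alpha\in S\}$. Let $W_+=\{w\in W\mid wS_0\subset R_+\}$, $\mathcal D=\bigcup_{w\in W_+}H_\eta(wS_0)$ and $I_{\mathcal D}=\{f\in\mathcal F\mid f|_{\mathcal D}=0\}$. Let $R_1,\dots,R_m$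 be the irreducible components of $R_0=\langle S_0\rangle\cap R$, $S_\ell=S_0\cap R_\ell$, and let $\theta_\ell=\sum_{\alpha\in S_\ell}n^\ell_\alpha\alpha$ be the maximal root of $R_\ell$ with respect to $S_\ell$. The generalized Coxeter number of $R_\ell$ is $h^\ell_\eta=\eta_{\theta_\ell}+\sum_{\alpha\in S_\ell}n^\ell_\alpha\eta_\alpha$. **Theorem.** Suppose that $h^\ell_\eta=\hbar$ for all $\ell=1,\dots,m$ and that $t_\alpha^2=e^{\eta_\alpha}$ for all $\alpha\in R$. Then the ideal $I_{\mathcal D}$ is invariant under $\mathbb H_t$ acting in its polynomial representation, $\mathbb H_tI_{\mathcal D}\subset I_{\mathcal D}$; that is, $I_{\mathcal D}$ is invariant under the algebra of operators on $\mathcal F$ generated by all $T_i$ ($0\le i\le n$), $X^\mu$ ($\mu\in\widehat P$) and $\pi_r$. -/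

import Mathlib

open scoped ContDiff Topology

namespace DAHA

universe u

section Calculus

variable {V : Type*} [NormedAddCommGroup V] [NormedSpace ℂ V]

theorem hasFDerivAt_paramIntegral [FiniteDimensional ℂ V] {F : Type*} [NormedAddCommGroup F] [NormedSpace ℂ F]
    [CompleteSpace F] {k : V × ℂ → F} (hk : ContDiff ℂ ∞ k) (x : V) :
    HasFDerivAt (fun y : V => ∫ u in (0 : ℝ)..1, k (y, (u : ℂ)))
      (∫ u in (0 : ℝ)..1, (fderiv ℂ k (x, (u : ℂ))).comp (ContinuousLinearMap.inl ℂ V ℂ)) x := by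
  have : ProperSpace V := FiniteDimensional.proper ℂ V
  let G : V → ℝ → (V →L[ℂ] F) := fun y u =>
    (fderiv ℂ k (y, (u : ℂ))).comp (ContinuousLinearMap.inl ℂ V ℂ)
  have hG : Continuous (fun p : V × ℝ => G p.1 p.2) := by
    have h1 : Continuous (fderiv ℂ k) := hk.continuous_fderiv (by simp)
    have h2 : Continuous (fun p : V × ℝ => fderiv ℂ k (p.1, (p.2 : ℂ))) :=
      h1.comp (by fun_prop)
    exact h2.clm_comp continuous_const
  have hkc : Continuous k := hk.continuous
  obtain ⟨C, hC⟩ := ((isCompact_closedBall x 1).prod (isCompact_Icc (a := (0 : ℝ)) (b := 1))).exists_bound_of_continuousOn hG.continuousOn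
  refine intervalIntegral.hasFDerivAt_integral_of_dominated_of_fderiv_le (𝕜 := ℂ)
    (F := fun y (u : ℝ) => k (y, (u : ℂ))) (F' := G) (bound := fun _ => C)
    (s := Metric.closedBall x 1) (Metric.closedBall_mem_nhds x one_pos) ?_ ?_ ?_ ?_ ?_ ?_
  · refine Filter.Eventually.of_forall fun y => ?_
    exact (hkc.comp (by fun_prop : Continuous fun u : ℝ => (y, (u : ℂ)))).aestronglyMeasurable
  · exact (hkc.comp (by fun_prop : Continuous fun u : ℝ => (x, (u : ℂ)))).intervalIntegrable _ _
  · exact (hG.comp (by fun_prop : Continuous fun u : ℝ => (x, u))).aestronglyMeasurable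
  · refine Filter.Eventually.of_forall fun u hu y hy => ?_
    rw [Set.uIoc_of_le zero_le_one] at hu
    exact hC (y, u) ⟨hy, hu.1.le, hu.2⟩
  · exact continuous_const.intervalIntegrable _ _
  · refine Filter.Eventually.of_forall fun u _ y _ => ?_
    have h1 : HasFDerivAt k (fderiv ℂ k (y, (u : ℂ))) (y, (u : ℂ)) :=
      (hk.differentiable (by simp) _).hasFDerivAt
    exact h1.comp y (hasFDerivAt_prodMk_left y (u : ℂ))

theorem contDiff_nat_paramIntegral {U : Type u} [NormedAddCommGroup U] [NormedSpace ℂ U]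
    [FiniteDimensional ℂ U] (n : ℕ) :
    ∀ (F : Type u) [NormedAddCommGroup F] [NormedSpace ℂ F] [CompleteSpace F] (k : U × ℂ → F),
      ContDiff ℂ ∞ k → ContDiff ℂ n (fun y : U => ∫ u in (0 : ℝ)..1, k (y, (u : ℂ))) := by
  induction n with
  | zero =>
    intro F _ _ _ k hk
    have h : Differentiable ℂ (fun y : U => ∫ u in (0 : ℝ)..1, k (y, (u : ℂ))) :=
      fun x => (hasFDerivAt_paramIntegral hk x).differentiableAt
    exact_mod_cast (contDiff_zero (𝕜 := ℂ)).2 h.continuous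
  | succ n ih =>
    intro F _ _ _ k hk
    push_cast
    refine contDiff_succ_iff_hasFDerivAt.2
      ⟨fun y : U => ∫ u in (0 : ℝ)..1,
        (fderiv ℂ k (y, (u : ℂ))).comp (ContinuousLinearMap.inl ℂ U ℂ), ?_,
        hasFDerivAt_paramIntegral hk⟩
    exact ih (U →L[ℂ] F) (fun p => (fderiv ℂ k p).comp (ContinuousLinearMap.inl ℂ U ℂ))
      ((hk.fderiv_right (by simp)).clm_comp contDiff_const)

theorem contDiff_paramIntegral [FiniteDimensional ℂ V] {k : V × ℂ → ℂ} (hk : ContDiff ℂ ∞ k) :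
    ContDiff ℂ ∞ (fun y : V => ∫ u in (0 : ℝ)..1, k (y, (u : ℂ))) := by
  rw [contDiff_infty]
  intro n
  have h : ContDiff ℂ ((n : ℕ∞ω) + 1) (fun y : V => ∫ u in (0 : ℝ)..1, k (y, (u : ℂ))) :=
    contDiff_succ_iff_hasFDerivAt.2 ⟨_,
      contDiff_nat_paramIntegral n (V →L[ℂ] ℂ)
        (fun p => (fderiv ℂ k p).comp (ContinuousLinearMap.inl ℂ V ℂ))
        ((hk.fderiv_right (by simp)).clm_comp contDiff_const), hasFDerivAt_paramIntegral hk⟩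
  exact h.of_le (by simp)

/-- The entire function `z ↦ (1 - exp (-z)) / z`, with value `1` at `0`. -/
noncomputable def expQuot : ℂ → ℂ := dslope (fun z => 1 - Complex.exp (-z)) 0

theorem expQuot_spec (z : ℂ) : z * expQuot z = 1 - Complex.exp (-z) := by
  have h := sub_smul_dslope (fun z : ℂ => 1 - Complex.exp (-z)) 0 z
  simpa [expQuot] using h

theorem expQuot_zero : expQuot 0 = 1 := by
  have h : HasDerivAt (fun z : ℂ => 1 - Complex.exp (-z)) 1 0 := by
    simpa using ((hasDerivAt_id (0 : ℂ)).neg.cexp.const_sub 1)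
  rw [expQuot, dslope_same, h.deriv]

theorem differentiable_expQuot : Differentiable ℂ expQuot := by
  have h : DifferentiableOn ℂ expQuot Set.univ :=
    (Complex.differentiableOn_dslope Filter.univ_mem).2 (by fun_prop)
  exact differentiableOn_univ.1 h

theorem exp_mul_integral {f : V → ℂ} (hf : ContDiff ℂ ∞ f) (x v : V) (z : ℂ) :
    z * (∫ u in (0 : ℝ)..1, fderiv ℂ f (x - ((u : ℂ) * z) • v) v) = f x - f (x - z • v) := by
  have hd : ∀ u : ℝ, HasDerivAt (fun u : ℝ => f (x - ((u : ℂ) * z) • v))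
      (-(z * fderiv ℂ f (x - ((u : ℂ) * z) • v) v)) u := by
    intro u
    have h1 : HasFDerivAt f (fderiv ℂ f (x - ((u : ℂ) * z) • v)) (x - ((u : ℂ) * z) • v) :=
      (hf.differentiable (by simp) _).hasFDerivAt
    have h2 : HasDerivAt (fun w : ℂ => x - (w * z) • v) (-(z • v)) (u : ℂ) := by
      simpa using (((hasDerivAt_id (u : ℂ)).mul_const z).smul_const v).const_sub x
    have h3 := (h1.comp_hasDerivAt (u : ℂ) h2).comp_ofReal
    simpa using h3
  have hc : Continuous fun u : ℝ => -(z * fderiv ℂ f (x - ((u : ℂ) * z) • v) v) := by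
    have h1 : Continuous (fderiv ℂ f) := hf.continuous_fderiv (by simp)
    have h2 : Continuous fun u : ℝ => fderiv ℂ f (x - ((u : ℂ) * z) • v) :=
      h1.comp (by fun_prop)
    exact (continuous_const.mul (h2.clm_apply continuous_const)).neg
  have h := intervalIntegral.integral_eq_sub_of_hasDerivAt (fun u _ => hd u)
    (hc.intervalIntegrable 0 1)
  simp only [intervalIntegral.integral_neg, intervalIntegral.integral_const_mul] at h
  simp at h
  linear_combination -h

end Calculus

section Setup

variable {ι M V : Type*} [AddCommGroup M] [Module ℂ M]
  [NormedAddCommGroup V] [NormedSpace ℂ V]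

/-- The affine root `[α, ħ k]`, the affine functional `x ↦ α(x) + ħ k` on `V`, where `α` is the
root with index `β.1` and `k = β.2`. -/
noncomputable def affRoot (P : RootPairing ι ℂ M V) (ħ : ℂ) (β : ι × ℤ) : V →ᵃ[ℂ] ℂ :=
  (P.root' β.1).toAffineMap + AffineMap.const ℂ V (ħ * (β.2 : ℂ))

theorem affRoot_apply (P : RootPairing ι ℂ M V) (ħ : ℂ) (β : ι × ℤ) (x : V) :
    affRoot P ħ β x = P.root' β.1 x + ħ * (β.2 : ℂ) := rfl

/-- The affine reflection `x ↦ x - β(x) α^∨` in the affine root `β = [α, ħ k]`. -/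
noncomputable def affRefl (P : RootPairing ι ℂ M V) (ħ : ℂ) (β : ι × ℤ) : V ≃ᵃ[ℂ] V :=
  AffineEquiv.constVAdd ℂ V (-(ħ * (β.2 : ℂ)) • P.coroot β.1) *
    (P.coreflection β.1).toAffineEquiv

theorem affRefl_apply (P : RootPairing ι ℂ M V) (ħ : ℂ) (β : ι × ℤ) (x : V) :
    affRefl P ħ β x = x - affRoot P ħ β x • P.coroot β.1 := by
  have h : affRefl P ħ β x
      = -(ħ * (β.2 : ℂ)) • P.coroot β.1 + P.coreflection β.1 x := rfl
  rw [h, affRoot_apply, RootPairing.coreflection_apply, add_smul, neg_smul]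
  abel

/-- The coweight lattice `P^∨`. -/
def coweightLattice (P : RootPairing ι ℂ M V) : AddSubgroup V where
  carrier := {l | ∀ i, ∃ n : ℤ, P.root' i l = n}
  zero_mem' := fun i => ⟨0, by simp⟩
  add_mem' := by
    intro a b ha hb i
    obtain ⟨m, hm⟩ := ha i
    obtain ⟨n, hn⟩ := hb i
    exact ⟨m + n, by rw [map_add, hm, hn]; push_cast; rfl⟩
  neg_mem' := by
    intro a ha i
    obtain ⟨m, hm⟩ := ha i
    exact ⟨-m, by rw [map_neg, hm]; push_cast; rfl⟩

/-- The weight lattice, as a lattice of linear functionals on `V`. -/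
def weightLattice (P : RootPairing ι ℂ M V) : AddSubgroup (Module.Dual ℂ V) where
  carrier := {μ | ∀ i, ∃ n : ℤ, μ (P.coroot i) = n}
  zero_mem' := fun i => ⟨0, by simp⟩
  add_mem' := by
    intro a b ha hb i
    obtain ⟨m, hm⟩ := ha i
    obtain ⟨n, hn⟩ := hb i
    exact ⟨m + n, by rw [LinearMap.add_apply, hm, hn]; push_cast; rfl⟩
  neg_mem' := by
    intro a ha i
    obtain ⟨m, hm⟩ := ha i
    exact ⟨-m, by rw [LinearMap.neg_apply, hm]; push_cast; rfl⟩

/-- The lattice of affine functionals `[μ, ħ m / ε₀]` with `μ` a weight and `m` an integer. -/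
noncomputable def affWeightLattice (P : RootPairing ι ℂ M V) (ħ : ℂ) (ε₀ : ℤ) :
    AddSubgroup (V →ᵃ[ℂ] ℂ) where
  carrier := {μ | μ.linear ∈ weightLattice P ∧ ∃ m : ℤ, μ 0 = ħ / (ε₀ : ℂ) * (m : ℂ)}
  zero_mem' := ⟨zero_mem (weightLattice P), 0, by simp⟩
  add_mem' := by
    rintro a b ⟨ha, m, hm⟩ ⟨hb, n, hn⟩
    refine ⟨add_mem ha hb, m + n, ?_⟩
    have h : (a + b) 0 = a 0 + b 0 := rfl
    rw [h, hm, hn]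
    push_cast
    ring
  neg_mem' := by
    rintro a ⟨ha, m, hm⟩
    refine ⟨neg_mem ha, -m, ?_⟩
    have h : (-a) 0 = -(a 0) := rfl
    rw [h, hm]
    push_cast
    ring

/-- The extended affine Weyl group `W ⋉ τ(P^∨)`, where `τ(λ)` is the shift by `ħ λ`, as a group of
affine transformations of `V`. -/
noncomputable def extAffineWeylGroup (P : RootPairing ι ℂ M V) (ħ : ℂ) :
    Subgroup (V ≃ᵃ[ℂ] V) :=
  Subgroup.closure
    (Set.range (fun i => (P.coreflection i).toAffineEquiv) ∪
      (fun l => AffineEquiv.constVAdd ℂ V (ħ • l)) '' (coweightLattice P : Set V))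

/-- The action of affine transformations of `V` on affine functionals, `w(φ) = φ ∘ w⁻¹`. -/
noncomputable def actFunctional (w : V ≃ᵃ[ℂ] V) (φ : V →ᵃ[ℂ] ℂ) : V →ᵃ[ℂ] ℂ :=
  φ.comp (w⁻¹ : V ≃ᵃ[ℂ] V).toAffineMap

/-- `θ` is the maximal element of the set `C` of roots with respect to the set `S` of simple roots:
`θ - β` is a combination of elements of `S` with coefficients in `ℕ` for every `β ∈ C`. -/
def IsMaximalRoot (P : RootPairing ι ℂ M V) (S C : Set ι) (θ : ι) : Prop :=
  θ ∈ C ∧ ∀ j ∈ C, P.root θ - P.root j ∈ AddSubmonoid.closure (P.root '' S)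

/-- The affine simple roots: `none` stands for `α₀ = [-θ, ħ]`, and `some i` for the simple
root `α_i = [α_i, 0]`. -/
def affSimple {P : RootPairing ι ℂ M V} (b : P.Base) (θ : ι) : Option b.support → ι × ℤ
  | none => (P.reflectionPerm θ θ, 1)
  | some i => (i, 0)

/-- The set of affine simple roots, as affine functionals. -/
def affSimpleSet {P : RootPairing ι ℂ M V} (b : P.Base) (θ : ι) (ħ : ℂ) : Set (V →ᵃ[ℂ] ℂ) :=
  Set.range fun i => affRoot P ħ (affSimple b θ i)

theorem actFunctional_mul (w w' : V ≃ᵃ[ℂ] V) (φ : V →ᵃ[ℂ] ℂ) :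
    actFunctional (w * w') φ = actFunctional w (actFunctional w' φ) := by
  ext x
  simp [actFunctional, mul_inv_rev]

theorem actFunctional_one (φ : V →ᵃ[ℂ] ℂ) : actFunctional 1 φ = φ := by
  ext x
  simp [actFunctional]

/-- The group `Π` of the elements of the extended affine Weyl group that preserve the set of
affine simple roots. -/
noncomputable def piGroup {P : RootPairing ι ℂ M V} (b : P.Base) (θ : ι) (ħ : ℂ) :
    Subgroup (V ≃ᵃ[ℂ] V) where
  carrier := {w | w ∈ extAffineWeylGroup P ħ ∧
    actFunctional w '' affSimpleSet b θ ħ = affSimpleSet b θ ħ}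
  one_mem' := by
    refine ⟨one_mem _, ?_⟩
    have h : actFunctional (1 : V ≃ᵃ[ℂ] V) = id := funext actFunctional_one
    rw [h, Set.image_id]
  mul_mem' := by
    rintro a c ⟨ha, ha'⟩ ⟨hc, hc'⟩
    refine ⟨mul_mem ha hc, ?_⟩
    have h : actFunctional (a * c) = actFunctional a ∘ actFunctional c :=
      funext (actFunctional_mul a c)
    rw [h, Set.image_comp, hc', ha']
  inv_mem' := by
    rintro a ⟨ha, ha'⟩
    refine ⟨inv_mem ha, ?_⟩
    have h : actFunctional a⁻¹ ∘ actFunctional a = id := by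
      funext φ
      rw [Function.comp_apply, ← actFunctional_mul, inv_mul_cancel, actFunctional_one, id]
    conv_lhs => rw [← ha']
    rw [← Set.image_comp, h, Set.image_id]

/-! ### The function space -/

/-- The algebra of smooth (infinitely complex differentiable, that is, entire) functions on the
complex vector space `V` that are periodic with respect to `2πi Q^∨`. -/
noncomputable def periodicFunctions (P : RootPairing ι ℂ M V) : Subalgebra ℂ (V → ℂ) where
  carrier := {f | ContDiff ℂ ∞ f ∧
    ∀ (i : ι) (x : V), f (x + (2 * Real.pi * Complex.I : ℂ) • P.coroot i) = f x}
  mul_mem' := by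
    rintro f g ⟨hf, hf'⟩ ⟨hg, hg'⟩
    exact ⟨hf.mul hg, fun i x => by simp only [Pi.mul_apply, hf', hg']⟩
  add_mem' := by
    rintro f g ⟨hf, hf'⟩ ⟨hg, hg'⟩
    exact ⟨hf.add hg, fun i x => by simp only [Pi.add_apply, hf', hg']⟩
  algebraMap_mem' := fun r => ⟨contDiff_const, fun i x => rfl⟩

theorem periodic_int {P : RootPairing ι ℂ M V} {f : V → ℂ} (hf : f ∈ periodicFunctions P)
    (i : ι) (n : ℤ) (x : V) :
    f (x + ((n : ℂ) * (2 * Real.pi * Complex.I : ℂ)) • P.coroot i) = f x := by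
  have h : Function.Periodic f ((2 * Real.pi * Complex.I : ℂ) • P.coroot i) := hf.2 i
  have h2 := h.zsmul n x
  rwa [← Int.cast_smul_eq_zsmul ℂ n, ← mul_smul] at h2

theorem contDiff_affineMap [FiniteDimensional ℂ V] {F : Type*} [NormedAddCommGroup F]
    [NormedSpace ℂ F] (φ : V →ᵃ[ℂ] F) :
    ContDiff ℂ ∞ (φ : V → F) := by
  have h : (φ : V → F) = fun x => LinearMap.toContinuousLinearMap φ.linear x + φ 0 := by
    funext x
    have := congrFun (AffineMap.decomp φ) x
    simpa using this
  rw [h]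
  fun_prop

theorem comp_mem [FiniteDimensional ℂ V] {P : RootPairing ι ℂ M V} {w : V ≃ᵃ[ℂ] V}
    (hw : ∀ i, ∃ j, w.linear (P.coroot i) = P.coroot j) {f : V → ℂ}
    (hf : f ∈ periodicFunctions P) : (fun x => f (w x)) ∈ periodicFunctions P := by
  refine ⟨hf.1.comp (contDiff_affineMap w.toAffineMap), fun i x => ?_⟩
  obtain ⟨j, hj⟩ := hw i
  have h : w (x + (2 * Real.pi * Complex.I : ℂ) • P.coroot i)
      = w x + (2 * Real.pi * Complex.I : ℂ) • P.coroot j := by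
    have := w.map_vadd x ((2 * Real.pi * Complex.I : ℂ) • P.coroot i)
    simp only [vadd_eq_add, map_smul, hj] at this
    rw [add_comm, this, add_comm]
  simp only [h, hf.2]

theorem linear_affRefl_coroot (P : RootPairing ι ℂ M V) (ħ : ℂ) (β : ι × ℤ) (i : ι) :
    ∃ j, (affRefl P ħ β).linear (P.coroot i) = P.coroot j :=
  ⟨P.reflectionPerm β.1 i, by rw [RootPairing.coroot_reflectionPerm]; rfl⟩

theorem linear_extAffineWeylGroup_coroot (P : RootPairing ι ℂ M V) (ħ : ℂ) {w : V ≃ᵃ[ℂ] V}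
    (hw : w ∈ extAffineWeylGroup P ħ) : ∀ i, ∃ j, w.linear (P.coroot i) = P.coroot j := by
  refine Subgroup.closure_induction''
    (p := fun w _ => ∀ i, ∃ j, w.linear (P.coroot i) = P.coroot j) ?_ ?_ ?_ ?_ hw
  · rintro w (⟨k, rfl⟩ | ⟨l, -, rfl⟩) i
    · exact ⟨P.reflectionPerm k i, by rw [RootPairing.coroot_reflectionPerm]; rfl⟩
    · exact ⟨i, rfl⟩
  · rintro w (⟨k, rfl⟩ | ⟨l, -, rfl⟩) i
    · exact ⟨P.reflectionPerm k i, by rw [RootPairing.coroot_reflectionPerm]; rfl⟩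
    · exact ⟨i, rfl⟩
  · exact fun i => ⟨i, rfl⟩
  · intro a c _ _ ha hc i
    obtain ⟨j, hj⟩ := hc i
    obtain ⟨k, hk⟩ := ha j
    refine ⟨k, ?_⟩
    rw [← hk, ← hj]
    rfl

theorem exp_affRoot_periodic (P : RootPairing ι ℂ M V) [P.IsCrystallographic] (ħ : ℂ)
    (β : ι × ℤ) (i : ι) (x : V) :
    Complex.exp (-affRoot P ħ β (x + (2 * Real.pi * Complex.I : ℂ) • P.coroot i))
      = Complex.exp (-affRoot P ħ β x) := by
  obtain ⟨n, hn⟩ := P.exists_value (S := ℤ) β.1 i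
  have hn' : P.root' β.1 (P.coroot i) = (n : ℂ) := by
    rw [RootPairing.root'_coroot_eq_pairing, ← hn]; simp
  rw [Complex.exp_eq_exp_iff_exists_int]
  refine ⟨-n, ?_⟩
  simp only [affRoot_apply, map_add, map_smul, hn', smul_eq_mul]
  push_cast
  ring

/-! ### The operators of the polynomial representation -/

open Classical in
/-- The function `(f - s_β f) / (1 - e^{-β})`. On the hyperplanes where `e^{-β} = 1` it is given by
its limit there, the derivative of `f` in the direction of the coroot. -/
noncomputable def divDiff (P : RootPairing ι ℂ M V) (ħ : ℂ) (β : ι × ℤ) (f : V → ℂ) (x : V) : ℂ :=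
  if Complex.exp (-affRoot P ħ β x) = 1 then fderiv ℂ f x (P.coroot β.1)
  else (f x - f (affRefl P ħ β x)) / (1 - Complex.exp (-affRoot P ħ β x))

theorem eq_of_exp_eq_one {P : RootPairing ι ℂ M V} {ħ : ℂ} {β : ι × ℤ} {f : V → ℂ}
    (hf : f ∈ periodicFunctions P) (n : ℤ) (x : V) :
    f (affRefl P ħ β x) =
      f (x - (affRoot P ħ β x + (n : ℂ) * (2 * Real.pi * Complex.I : ℂ)) • P.coroot β.1) := by
  rw [affRefl_apply, ← periodic_int hf β.1 n
    (x - (affRoot P ħ β x + (n : ℂ) * (2 * Real.pi * Complex.I : ℂ)) • P.coroot β.1)]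
  congr 1
  rw [add_smul]
  abel

theorem divDiff_mul {P : RootPairing ι ℂ M V} {ħ : ℂ} {β : ι × ℤ} {f : V → ℂ}
    (hf : f ∈ periodicFunctions P) (x : V) :
    (1 - Complex.exp (-affRoot P ħ β x)) * divDiff P ħ β f x = f x - f (affRefl P ħ β x) := by
  unfold divDiff
  split_ifs with h
  · obtain ⟨n, hn⟩ := Complex.exp_eq_one_iff.1 h
    have h0 : affRoot P ħ β x + (n : ℂ) * (2 * Real.pi * Complex.I : ℂ) = 0 := by
      rw [← hn]; ring
    rw [eq_of_exp_eq_one hf n x, h0, h]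
    simp
  · have h1 : 1 - Complex.exp (-affRoot P ħ β x) ≠ 0 := sub_ne_zero.2 (Ne.symm h)
    field_simp

theorem divDiff_mem [FiniteDimensional ℂ V] {P : RootPairing ι ℂ M V} [P.IsCrystallographic]
    {ħ : ℂ} {β : ι × ℤ} {f : V → ℂ} (hf : f ∈ periodicFunctions P) :
    divDiff P ħ β f ∈ periodicFunctions P := by
  classical
  have hs : (fun x => f (affRefl P ħ β x)) ∈ periodicFunctions P :=
    comp_mem (linear_affRefl_coroot P ħ β) hf
  have hβ : ContDiff ℂ ∞ (fun x => affRoot P ħ β x) := contDiff_affineMap _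
  have hE : ContDiff ℂ ∞ (fun x => Complex.exp (-affRoot P ħ β x)) := hβ.neg.cexp
  refine ⟨contDiff_iff_contDiffAt.2 fun x₀ => ?_, fun i x => ?_⟩
  · by_cases h : Complex.exp (-affRoot P ħ β x₀) = 1
    · obtain ⟨n, hn⟩ := Complex.exp_eq_one_iff.1 h
      set v := P.coroot β.1 with hv
      set z : V → ℂ := fun x => affRoot P ħ β x + (n : ℂ) * (2 * Real.pi * Complex.I : ℂ) with hz
      have hz0 : z x₀ = 0 := by rw [hz]; simp only [← hn]; ring
      have hzC : ContDiff ℂ ∞ z := hβ.add contDiff_const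
      have hzE : ∀ x, Complex.exp (-z x) = Complex.exp (-affRoot P ħ β x) := by
        intro x
        rw [Complex.exp_eq_exp_iff_exists_int]
        exact ⟨-n, by simp only [hz]; push_cast; ring⟩
      set K : V → ℂ := fun x => ∫ u in (0 : ℝ)..1, fderiv ℂ f (x - ((u : ℂ) * z x) • v) v with hK
      have hKC : ContDiff ℂ ∞ K := by
        refine contDiff_paramIntegral (k := fun p : V × ℂ => fderiv ℂ f (p.1 - (p.2 * z p.1) • v) v)
          ?_
        have h1 : ContDiff ℂ ∞ (fderiv ℂ f) := hf.1.fderiv_right (by simp)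
        have h2 : ContDiff ℂ ∞ (fun p : V × ℂ => p.1 - (p.2 * z p.1) • v) :=
          contDiff_fst.sub ((contDiff_snd.mul (hzC.comp contDiff_fst)).smul contDiff_const)
        exact (h1.comp h2).clm_apply contDiff_const
      have hQC : ContDiff ℂ ∞ (fun x => expQuot (z x)) :=
        differentiable_expQuot.contDiff.comp hzC
      have hQ0 : expQuot (z x₀) ≠ 0 := by rw [hz0, expQuot_zero]; exact one_ne_zero
      have hev : ∀ᶠ x in 𝓝 x₀, expQuot (z x) ≠ 0 :=
        hQC.continuous.continuousAt.eventually_ne hQ0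
      refine (hKC.contDiffAt.div hQC.contDiffAt hQ0).congr_of_eventuallyEq ?_
      filter_upwards [hev] with x hx
      have hKx : z x * K x = f x - f (affRefl P ħ β x) := by
        rw [eq_of_exp_eq_one hf n x]
        exact exp_mul_integral hf.1 x v (z x)
      have hq := expQuot_spec (z x)
      rw [hzE] at hq
      unfold divDiff
      split_ifs with hx1
      · rw [hx1, sub_self] at hq
        have hzx : z x = 0 := (mul_eq_zero.1 hq).resolve_right hx
        simp only [Pi.div_apply, hK, hzx, expQuot_zero]
        simp [hv]
      · rw [← hKx, ← hq]
        have hzx : z x ≠ 0 := by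
          intro h0
          rw [h0, zero_mul] at hq
          exact hx1 (sub_eq_zero.1 hq.symm).symm
        simp only [Pi.div_apply]
        field_simp
    · have h1 : 1 - Complex.exp (-affRoot P ħ β x₀) ≠ 0 := sub_ne_zero.2 (Ne.symm h)
      have hev : ∀ᶠ x in 𝓝 x₀, Complex.exp (-affRoot P ħ β x) ≠ 1 :=
        hE.continuous.continuousAt.eventually_ne h
      refine ((hf.1.sub hs.1).contDiffAt.div
        (contDiff_const.sub hE).contDiffAt h1).congr_of_eventuallyEq ?_
      filter_upwards [hev] with x hx
      unfold divDiff
      rw [if_neg hx]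
      rfl
  · have h1 : fderiv ℂ f (x + (2 * Real.pi * Complex.I : ℂ) • P.coroot i) = fderiv ℂ f x := by
      rw [← fderiv_comp_add_right]
      exact congrArg (fun g => fderiv ℂ g x) (funext fun y => hf.2 i y)
    have h2 := hs.2 i x
    simp only at h2
    unfold divDiff
    rw [exp_affRoot_periodic, h1, hf.2, h2]

/-- The operator `(τ - τ⁻¹) / (1 - e^{-β}) + (τ⁻¹ - τ e^{-β}) / (1 - e^{-β}) s_β` associated with an
affine root `β`, in the form `τ - (τ⁻¹ - τ e^{-β}) (1 - s_β) / (1 - e^{-β})`. -/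
noncomputable def opT [FiniteDimensional ℂ V] (P : RootPairing ι ℂ M V) [P.IsCrystallographic]
    (ħ : ℂ) (β : ι × ℤ) (τ : ℂˣ) : Module.End ℂ (periodicFunctions P) where
  toFun f := ⟨fun x => (τ : ℂ) * f.1 x -
      ((τ : ℂ)⁻¹ - (τ : ℂ) * Complex.exp (-affRoot P ħ β x)) * divDiff P ħ β f.1 x, by
    have hq := divDiff_mem (ħ := ħ) (β := β) f.2
    have hE : ContDiff ℂ ∞ (fun x => Complex.exp (-affRoot P ħ β x)) :=
      (contDiff_affineMap (affRoot P ħ β)).neg.cexp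
    refine ⟨(contDiff_const.mul f.2.1).sub
      ((contDiff_const.sub (contDiff_const.mul hE)).mul hq.1), fun i x => ?_⟩
    simp only
    rw [exp_affRoot_periodic, f.2.2, hq.2]⟩
  map_add' f g := by
    ext x
    have h : fderiv ℂ (f.1 + g.1) x = fderiv ℂ f.1 x + fderiv ℂ g.1 x :=
      fderiv_add (f.2.1.differentiable (by simp) x) (g.2.1.differentiable (by simp) x)
    change (τ : ℂ) * (f.1 x + g.1 x) - _ * divDiff P ħ β (f.1 + g.1) x
      = ((τ : ℂ) * f.1 x - _) + ((τ : ℂ) * g.1 x - _)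
    unfold divDiff
    split_ifs
    · rw [h, add_apply]
      ring
    · simp only [Pi.add_apply]
      ring
  map_smul' c f := by
    ext x
    have h : fderiv ℂ (c • f.1) x = c • fderiv ℂ f.1 x :=
      fderiv_const_smul (f.2.1.differentiable (by simp) x) c
    change (τ : ℂ) * (c * f.1 x) - _ * divDiff P ħ β (c • f.1) x
      = c * ((τ : ℂ) * f.1 x - _)
    unfold divDiff
    split_ifs
    · rw [h, smul_apply, smul_eq_mul]
      ring
    · simp only [Pi.smul_apply, smul_eq_mul]
      ring

/-- `opT` satisfies its defining formula wherever the formula makes sense. -/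
theorem opT_apply [FiniteDimensional ℂ V] (P : RootPairing ι ℂ M V) [P.IsCrystallographic]
    (ħ : ℂ) (β : ι × ℤ) (τ : ℂˣ) (f : periodicFunctions P) (x : V)
    (hx : Complex.exp (-affRoot P ħ β x) ≠ 1) :
    (opT P ħ β τ f).1 x =
      ((τ : ℂ) - (τ : ℂ)⁻¹) / (1 - Complex.exp (-affRoot P ħ β x)) * f.1 x +
      ((τ : ℂ)⁻¹ - (τ : ℂ) * Complex.exp (-affRoot P ħ β x)) /
        (1 - Complex.exp (-affRoot P ħ β x)) * f.1 (affRefl P ħ β x) := by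
  have h1 : 1 - Complex.exp (-affRoot P ħ β x) ≠ 0 := sub_ne_zero.2 (Ne.symm hx)
  change (τ : ℂ) * f.1 x - _ * divDiff P ħ β f.1 x = _
  unfold divDiff
  rw [if_neg hx]
  field_simp
  ring

/-- The operator `X^μ` of multiplication by the function `x ↦ e^{μ(x)}`. -/
noncomputable def opX [FiniteDimensional ℂ V] (P : RootPairing ι ℂ M V) (ħ : ℂ) (ε₀ : ℤ)
    (μ : affWeightLattice P ħ ε₀) : Module.End ℂ (periodicFunctions P) :=
  LinearMap.mulLeft ℂ (⟨fun x => Complex.exp (μ.1 x), by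
    refine ⟨(contDiff_affineMap μ.1).cexp, fun i x => ?_⟩
    obtain ⟨n, hn⟩ := μ.2.1 i
    rw [Complex.exp_eq_exp_iff_exists_int]
    refine ⟨n, ?_⟩
    have h := μ.1.map_vadd x ((2 * Real.pi * Complex.I : ℂ) • P.coroot i)
    simp only [vadd_eq_add, map_smul, hn, smul_eq_mul] at h
    rw [add_comm x, h]
    ring⟩ : periodicFunctions P)

/-- The action `(w f)(x) = f (w⁻¹ x)` of the extended affine Weyl group. -/
noncomputable def opW [FiniteDimensional ℂ V] (P : RootPairing ι ℂ M V) (ħ : ℂ)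
    (w : extAffineWeylGroup P ħ) : Module.End ℂ (periodicFunctions P) where
  toFun f := ⟨fun x => f.1 ((w⁻¹).1 x),
    comp_mem (linear_extAffineWeylGroup_coroot P ħ (w⁻¹).2) f.2⟩
  map_add' _ _ := rfl
  map_smul' _ _ := rfl

/-! ### The double affine Hecke algebra -/

/-- Generators of the double affine Hecke algebra. -/
inductive Gen {P : RootPairing ι ℂ M V} (b : P.Base) (θ : ι) (ħ : ℂ) (ε₀ : ℤ) : Type _
  | T (i : Option b.support)
  | X (μ : affWeightLattice P ħ ε₀)
  | pi (r : piGroup b θ ħ)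

/-- The alternating product `x y x y ⋯` with `n` factors. -/
def altProd {A : Type*} [Monoid A] (x y : A) : ℕ → A
  | 0 => 1
  | n + 1 => x * altProd y x n

section Algebra

variable {P : RootPairing ι ℂ M V} (b : P.Base) (θ : ι) (ħ : ℂ) (ε₀ : ℤ) (t : ι × ℤ → ℂˣ)

/-- The generator `T_i` in the free algebra. -/
noncomputable def gT (i : Option b.support) : FreeAlgebra ℂ (Gen b θ ħ ε₀) :=
  FreeAlgebra.ι ℂ (Gen.T i)

/-- The generator `X^μ` in the free algebra. -/
noncomputable def gX (μ : affWeightLattice P ħ ε₀) : FreeAlgebra ℂ (Gen b θ ħ ε₀) :=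
  FreeAlgebra.ι ℂ (Gen.X μ)

/-- The generator `π_r` in the free algebra. -/
noncomputable def gPi (r : piGroup b θ ħ) : FreeAlgebra ℂ (Gen b θ ħ ε₀) :=
  FreeAlgebra.ι ℂ (Gen.pi r)

/-- The affine simple root `α_i`. -/
noncomputable def simpleRoot (i : Option b.support) : V →ᵃ[ℂ] ℂ :=
  affRoot P ħ (affSimple b θ i)

/-- The simple affine reflection `s_i`. -/
noncomputable def simpleRefl (i : Option b.support) : V ≃ᵃ[ℂ] V :=
  affRefl P ħ (affSimple b θ i)

/-- The simple affine coroot `α_i^∨`, of which only the gradient is needed. -/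
noncomputable def simpleCoroot (i : Option b.support) : V :=
  P.coroot (affSimple b θ i).1

/-- Defining relations of the double affine Hecke algebra. The relation `mulX_T` is
`T_i⁻¹ X^μ T_i⁻¹ = X^{μ - α_i}` multiplied by `T_i` on both sides. -/
inductive Rel :
    FreeAlgebra ℂ (Gen b θ ħ ε₀) → FreeAlgebra ℂ (Gen b θ ħ ε₀) → Prop
  | X_mul (μ ν : affWeightLattice P ħ ε₀) :
      Rel (gX b θ ħ ε₀ μ * gX b θ ħ ε₀ ν) (gX b θ ħ ε₀ (μ + ν))
  | X_const (μ : affWeightLattice P ħ ε₀) (c : ℂ) (hμ : μ.1 = AffineMap.const ℂ V c) :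
      Rel (gX b θ ħ ε₀ μ) (algebraMap ℂ _ (Complex.exp c))
  | pi_one : Rel (gPi b θ ħ ε₀ 1) 1
  | pi_mul (r s : piGroup b θ ħ) :
      Rel (gPi b θ ħ ε₀ r * gPi b θ ħ ε₀ s) (gPi b θ ħ ε₀ (r * s))
  | quadratic (i : Option b.support) :
      Rel ((gT b θ ħ ε₀ i - algebraMap ℂ _ (t (affSimple b θ i) : ℂ)) *
        (gT b θ ħ ε₀ i + algebraMap ℂ _ (t (affSimple b θ i) : ℂ)⁻¹)) 0
  | braid (i j : Option b.support) (hij : i ≠ j)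
      (hm : IsOfFinOrder (simpleRefl b θ ħ i * simpleRefl b θ ħ j)) :
      Rel (altProd (gT b θ ħ ε₀ i) (gT b θ ħ ε₀ j)
          (orderOf (simpleRefl b θ ħ i * simpleRefl b θ ħ j)))
        (altProd (gT b θ ħ ε₀ j) (gT b θ ħ ε₀ i)
          (orderOf (simpleRefl b θ ħ i * simpleRefl b θ ħ j)))
  | pi_T (r : piGroup b θ ħ) (i j : Option b.support)
      (hr : actFunctional r.1 (simpleRoot b θ ħ i) = simpleRoot b θ ħ j) :
      Rel (gPi b θ ħ ε₀ r * gT b θ ħ ε₀ i * gPi b θ ħ ε₀ r⁻¹) (gT b θ ħ ε₀ j)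
  | T_X_one (i : Option b.support) (μ ν : affWeightLattice P ħ ε₀)
      (hμ : μ.1.linear (simpleCoroot b θ i) = 1) (hν : ν.1 = μ.1 - simpleRoot b θ ħ i) :
      Rel (gX b θ ħ ε₀ μ) (gT b θ ħ ε₀ i * gX b θ ħ ε₀ ν * gT b θ ħ ε₀ i)
  | T_X_zero (i : Option b.support) (μ : affWeightLattice P ħ ε₀)
      (hμ : μ.1.linear (simpleCoroot b θ i) = 0) :
      Rel (gT b θ ħ ε₀ i * gX b θ ħ ε₀ μ) (gX b θ ħ ε₀ μ * gT b θ ħ ε₀ i)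
  | pi_X (r : piGroup b θ ħ) (μ ν : affWeightLattice P ħ ε₀)
      (hν : ν.1 = actFunctional r.1 μ.1) :
      Rel (gPi b θ ħ ε₀ r * gX b θ ħ ε₀ μ * gPi b θ ħ ε₀ r⁻¹) (gX b θ ħ ε₀ ν)

/-- The double affine Hecke algebra, by generators and relations. -/
abbrev DoubleAffineHeckeAlgebra := RingQuot (Rel b θ ħ ε₀ t)

/-- The generators as elements of the double affine Hecke algebra. -/
noncomputable def genElem (g : Gen b θ ħ ε₀) : DoubleAffineHeckeAlgebra b θ ħ ε₀ t :=
  RingQuot.mkAlgHom ℂ (Rel b θ ħ ε₀ t) (FreeAlgebra.ι ℂ g)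

/-- The operators by which the generators act in the polynomial representation. -/
noncomputable def genOp [FiniteDimensional ℂ V] [P.IsCrystallographic] :
    Gen b θ ħ ε₀ → Module.End ℂ (periodicFunctions P)
  | Gen.T i => opT P ħ (affSimple b θ i) (t (affSimple b θ i))
  | Gen.X μ => opX P ħ ε₀ μ
  | Gen.pi r => opW P ħ ⟨r.1, r.2.1⟩

end Algebra

/-! ### The arrangement and its ideal -/

/-- The plane `H_η(S) = {x ∈ V | α(x) = η_α for all α ∈ S}`. -/
def plane (P : RootPairing ι ℂ M V) (η : ι → ℂ) (S : Set ι) : Set V :=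
  {x | ∀ i ∈ S, P.root' i x = η i}

/-- The set `W_+` of the elements `w` of the Weyl group with `w S₀ ⊆ R_+`. -/
def weylPlus {P : RootPairing ι ℂ M V} (b : P.Base) (S₀ : Set ι) : Set P.weylGroup :=
  {w | ∀ i ∈ S₀, b.IsPos (w • i)}

/-- The union of the planes `H_η(w S₀)` over `w ∈ W_+`. -/
def arrangement {P : RootPairing ι ℂ M V} (b : P.Base) (η : ι → ℂ) (S₀ : Set ι) : Set V :=
  ⋃ w ∈ weylPlus b S₀, plane P η ((fun i => w • i) '' S₀)

/-- The ideal of the functions that vanish on the subset `D` of `V`. -/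
def vanishingIdeal (P : RootPairing ι ℂ M V) (D : Set V) : Ideal (periodicFunctions P) where
  carrier := {f | ∀ x ∈ D, f.1 x = 0}
  zero_mem' := fun _ _ => rfl
  add_mem' := by
    intro f g hf hg x hx
    change f.1 x + g.1 x = 0
    rw [hf x hx, hg x hx, add_zero]
  smul_mem' := by
    intro c f hf x hx
    change c.1 x * f.1 x = 0
    rw [hf x hx, mul_zero]

/-! ### Generalized Coxeter numbers -/

/-- The root subsystem `⟨S₀⟩ ∩ R`. -/
def spannedRoots (P : RootPairing ι ℂ M V) (S₀ : Set ι) : Set ι :=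
  {i | P.root i ∈ Submodule.span ℂ (P.root '' S₀)}

/-- `C` is an irreducible component of the set `R₀` of roots: it is non-empty, orthogonal to its
complement in `R₀`, and not a disjoint union of two non-empty mutually orthogonal subsets. -/
structure IsIrreducibleComponent (P : RootPairing ι ℂ M V) (R₀ C : Set ι) : Prop where
  subset : C ⊆ R₀
  nonempty : C.Nonempty
  orthogonal : ∀ i ∈ C, ∀ j ∈ R₀ \ C, P.pairing i j = 0
  indecomposable : ∀ C' ⊆ C, C'.Nonempty → (∀ i ∈ C', ∀ j ∈ C \ C', P.pairing i j = 0) → C' = C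

/-- `h` is the generalized Coxeter number of the irreducible root system `C` with simple roots `S`:
`h = η_θ + ∑ n_j η_{α_j}`, where `θ = ∑ n_j α_j` is the maximal root. -/
def IsGenCoxeterNumber (P : RootPairing ι ℂ M V) (η : ι → ℂ) (S C : Set ι) (h : ℂ) : Prop :=
  ∃ (θ : ι) (n : ι →₀ ℕ), IsMaximalRoot P S C θ ∧ (n.support : Set ι) ⊆ S ∧
    P.root θ = n.sum (fun j m => m • P.root j) ∧ h = η θ + n.sum (fun j m => m • η j)

end Setup

end DAHA

open DAHA

/-! The operators that preserve the ideal form a subalgebra, so it is enough to treat the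
generators; multiplication by `X^μ` is immediate. Fix `w ∈ W_+`. The Coxeter number condition says
exactly that on the plane `H_η(wS₀)` not only the simple roots of `wR₀` but also its affine simple
roots `[-wθ_ℓ, ħ]` take their `η`-values. The plane is therefore described symmetrically by all
affine simple roots of `wR₀`, collected in `movedAffineSimple`.

The geometric core is `apply_mem_arrangement`: if `g` in the extended affine Weyl group moves all
these affine simple roots to positive affine roots, then `g` moves the plane into the arrangement.
Positivity puts the translation part of `g` into a closed alcove, and `exists_smul_mem_walls` finds
an element of the Weyl group that carries `S₀` into the set of walls through that point. The
corresponding affine roots are moved by `g` to positive roots of level zero, and these exhibit the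
image as part of a plane `H_η(w'S₀)` with `w' ∈ W_+`.

For `T_j` there are two cases. If the gradient of `α_j` lies in the span of `wS₀`, then `α_j` is
itself an affine simple root of `wR₀`, so `e^{α_j} = t_j²` on the plane and the coefficient in front
of the divided difference vanishes there. Otherwise `s_j` keeps the affine simple roots of `wR₀`
positive, so `f` and `s_j f` both vanish on the plane; hence so does `T_j f` off the poles of its
coefficients, and then everywhere by continuity. Elements of `Π` permute the affine simple roots and
so preserve positivity. -/

namespace DAHA

/-! ### Additive cones and linear forms on them -/

section Closure

variable {A : Type*} [AddCommGroup A]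

theorem nonneg_of_mem_closure {X : Set A} (f : A →+ ℝ) (hf : ∀ x ∈ X, 0 ≤ f x) {m : A}
    (hm : m ∈ AddSubmonoid.closure X) : 0 ≤ f m := by
  induction hm using AddSubmonoid.closure_induction with
  | mem x hx => exact hf x hx
  | zero => simp
  | add x y _ _ hx hy => rw [map_add]; exact add_nonneg hx hy

/-- In a cone, the elements of height one are generators. -/
theorem mem_of_mem_closure_of_height_eq_one {X : Set A} (f : A →+ ℝ) (hf : ∀ x ∈ X, 1 ≤ f x) {m : A}
    (hm : m ∈ AddSubmonoid.closure X) (h1 : f m = 1) : m ∈ X := by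
  -- The trichotomy survives addition because two non-zero elements have heights adding up to at
  -- least 2.
  have key : m = 0 ∨ m ∈ X ∨ 2 ≤ f m := by
    clear h1
    have h (x : A) (h : x = 0 ∨ x ∈ X ∨ 2 ≤ f x) : x = 0 ∨ 1 ≤ f x := by
      rcases h with h | h | h
      · exact Or.inl h
      · exact Or.inr (hf x h)
      · exact Or.inr (by linarith)
    induction hm using AddSubmonoid.closure_induction with
    | mem x hx => exact Or.inr (Or.inl hx)
    | zero => exact Or.inl rfl
    | add x y _ _ hx hy =>
      rcases h x hx with rfl | hx'
      · simpa using hy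
      rcases h y hy with rfl | hy'
      · simpa using hx
      · refine Or.inr (Or.inr ?_)
        rw [map_add]
        linarith
  rcases key with h | h | h
  · simp [h] at h1
  · exact h
  · linarith

/-- A sum of non-positive numbers vanishes only if every summand does, so a face of the cone is
generated by the generators lying on it. -/
theorem mem_closure_ker_of_nonpos {X : Set A} (f : A →+ ℝ) (hf : ∀ x ∈ X, f x ≤ 0) {m : A}
    (hm : m ∈ AddSubmonoid.closure X) (h0 : f m = 0) :
    m ∈ AddSubmonoid.closure {x ∈ X | f x = 0} := by
  have key : f m ≤ 0 ∧ (f m = 0 → m ∈ AddSubmonoid.closure {x ∈ X | f x = 0}) := by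
    clear h0
    induction hm using AddSubmonoid.closure_induction with
    | mem x hx => exact ⟨hf x hx, fun h => AddSubmonoid.subset_closure ⟨hx, h⟩⟩
    | zero => exact ⟨by simp, fun _ => zero_mem _⟩
    | add x y _ _ hx hy =>
      rw [map_add]
      exact ⟨add_nonpos hx.1 hy.1, fun h => add_mem (hx.2 (by linarith [hx.1, hy.1]))
        (hy.2 (by linarith [hx.1, hy.1]))⟩
  exact key.2 h0

end Closure

/-! ### Heights, positive roots and parabolic subsystems -/

section RootSystems

variable {ι M V : Type*} [AddCommGroup M] [Module ℂ M]
  [NormedAddCommGroup V] [NormedSpace ℂ V] {P : RootPairing ι ℂ M V}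

/-- The real part of the pairing with a fixed vector. -/
noncomputable def rePairing (P : RootPairing ι ℂ M V) (v : V) : M →+ ℝ :=
  Complex.reAddGroupHom.comp (P.toLinearMap.flip v).toAddMonoidHom

theorem rePairing_apply (v : V) (m : M) : rePairing P v m = (P.toLinearMap m v).re := rfl

/-- The simple roots are a basis. Constant values 1 give the vector `ρ` whose pairing with a root is
its height; indicator functions give the fundamental coweights. -/
theorem exists_root'_eq [P.IsRootSystem] (b : P.Base) (c : ι → ℂ) :
    ∃ v : V, ∀ i ∈ b.support, P.root' i v = c i := by
  obtain ⟨v, hv⟩ := P.flip.toPerfPair.surjective (b.toWeightBasis.constr ℂ fun i => c i)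
  refine ⟨v, fun i hi => ?_⟩
  have h := LinearMap.congr_fun hv (P.root i)
  have h2 := b.toWeightBasis.constr_basis ℂ (fun i => c i) ⟨i, hi⟩
  rw [b.toWeightBasis_apply] at h2
  rw [h2] at h
  exact h

/-- Constant values 1 give a weight `y` with `s_i y = y - α_i` for all simple `α_i`. -/
theorem exists_coroot'_eq [P.IsRootSystem] (b : P.Base) (c : ι → ℂ) :
    ∃ y : M, ∀ i ∈ b.support, P.toLinearMap y (P.coroot i) = c i := by
  obtain ⟨v, hv⟩ := P.toPerfPair.surjective (b.toCoweightBasis.constr ℂ fun i => c i)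
  refine ⟨v, fun i hi => ?_⟩
  have h := LinearMap.congr_fun hv (P.coroot i)
  have h2 := b.toCoweightBasis.constr_basis ℂ (fun i => c i) ⟨i, hi⟩
  rw [b.toCoweightBasis_apply] at h2
  rw [h2] at h
  exact h

theorem root'_eq_height (b : P.Base) {ρ : V} (hρ : ∀ i ∈ b.support, P.root' i ρ = 1) (i : ι) :
    P.root' i ρ = (b.height i : ℂ) := by
  obtain ⟨f, -, -, hf⟩ := b.exists_root_eq_sum_int i
  rw [b.height_eq_sum hf, RootPairing.root', hf, map_sum, LinearMap.sum_apply, Int.cast_sum]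
  refine Finset.sum_congr rfl fun j hj => ?_
  rw [map_zsmul, LinearMap.smul_apply, hρ j hj]
  simp

theorem rePairing_root (b : P.Base) {ρ : V} (hρ : ∀ i ∈ b.support, P.root' i ρ = 1) (i : ι) :
    rePairing P ρ (P.root i) = (b.height i : ℝ) := by
  have h := congrArg Complex.re (root'_eq_height b hρ i)
  simpa using! h

/-- Positivity is defined through the sign of the height. Since `ρ` is non-negative on the cone of
simple roots and every root or its negative lies in that cone, the two notions agree. -/
theorem isPos_iff_mem_closure [P.IsRootSystem] (b : P.Base) (i : ι) :
    b.IsPos i ↔ P.root i ∈ AddSubmonoid.closure (P.root '' (b.support : Set ι)) := by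
  obtain ⟨ρ, hρ⟩ := exists_root'_eq b (fun _ => 1)
  have key : ∀ m ∈ AddSubmonoid.closure (P.root '' (b.support : Set ι)), 0 ≤ rePairing P ρ m := by
    intro m hm
    refine nonneg_of_mem_closure _ ?_ hm
    rintro _ ⟨j, hj, rfl⟩
    rw [rePairing_root b hρ, b.height_one_of_mem_support hj]
    simp
  constructor
  · intro h
    refine (b.root_mem_or_neg_mem i).resolve_right fun h2 => ?_
    have h3 := key _ h2
    rw [map_neg, rePairing_root b hρ] at h3
    have h4 : (0 : ℝ) < b.height i := by exact_mod_cast h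
    linarith
  · intro h
    have h3 := key _ h
    rw [rePairing_root b hρ] at h3
    exact b.isPos_iff'.2 (by exact_mod_cast h3)

theorem isPos_of_mem_closure [P.IsRootSystem] (b : P.Base) {i : ι} {S : Set ι}
    (hS : ∀ j ∈ S, b.IsPos j) (h : P.root i ∈ AddSubmonoid.closure (P.root '' S)) : b.IsPos i := by
  rw [isPos_iff_mem_closure]
  refine AddSubmonoid.closure_le.2 ?_ h
  rintro _ ⟨j, hj, rfl⟩
  exact (isPos_iff_mem_closure b j).1 (hS j hj)

/-- A root in the span of a set of simple roots is a combination of these with coefficients of the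
same sign. -/
theorem mem_closure_or_neg_of_mem_spannedRoots [P.IsRootSystem] (b : P.Base) {S : Set ι} (hS : S ⊆ b.support) {i : ι}
    (hi : i ∈ spannedRoots P S) :
    P.root i ∈ AddSubmonoid.closure (P.root '' S) ∨
      -P.root i ∈ AddSubmonoid.closure (P.root '' S) := by
  classical
  obtain ⟨f, hf, h⟩ := b.exists_root_eq_sum_nat_or_neg i
  have hi' : P.root i ∈ Submodule.span ℂ (P.root '' S) := hi
  have hsum : ∑ j ∈ b.support, f j • P.root j ∈ Submodule.span ℂ (P.root '' S) := by
    rcases h with h | h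
    · rwa [← h]
    · rw [h, neg_mem_iff] at hi'
      exact hi'
  -- The fundamental coweight of `j ∉ S` annihilates the span of `S` and reads off the coefficient
  -- `f j`.
  have hz : ∀ j ∈ b.support, j ∉ S → f j = 0 := by
    intro j hj hjS
    obtain ⟨v, hv⟩ := exists_root'_eq b (Pi.single j 1)
    have h1 : ∀ m ∈ Submodule.span ℂ (P.root '' S), P.toLinearMap m v = 0 := by
      intro m hm
      induction hm using Submodule.span_induction with
      | mem x hx =>
        obtain ⟨k, hk, rfl⟩ := hx
        rw [← RootPairing.root', hv k (hS hk), Pi.single_eq_of_ne (ne_of_mem_of_not_mem hk hjS)]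
      | zero => simp
      | add x y _ _ hx hy => rw [map_add, LinearMap.add_apply, hx, hy, add_zero]
      | smul c x _ hx => rw [map_smul, LinearMap.smul_apply, hx, smul_zero]
    have h2 := h1 _ hsum
    rw [map_sum, LinearMap.sum_apply, Finset.sum_eq_single_of_mem j hj] at h2
    · rw [map_nsmul, LinearMap.smul_apply, ← RootPairing.root', hv j hj, Pi.single_eq_same] at h2
      simpa using h2
    · intro k hk hkj
      rw [map_nsmul, LinearMap.smul_apply, ← RootPairing.root', hv k hk,
        Pi.single_eq_of_ne hkj, smul_zero]
  have hmem : ∑ j ∈ b.support, f j • P.root j ∈ AddSubmonoid.closure (P.root '' S) := by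
    refine sum_mem fun j hj => ?_
    by_cases hjS : j ∈ S
    · exact nsmul_mem (AddSubmonoid.subset_closure (Set.mem_image_of_mem _ hjS)) _
    · rw [hz j hj hjS, zero_smul]; exact zero_mem _
  rcases h with h | h
  · left; rwa [h]
  · right; rwa [h, neg_neg]

/-! ### The Weyl group -/

theorem root_smul (w : P.weylGroup) (i : ι) : P.root (w • i) = w • P.root i :=
  RootPairing.Equiv.root_indexEquiv_eq_smul P i w.1

theorem ofIdx_smul_eq (i : ι) (m : M) :
    RootPairing.weylGroup.ofIdx P i • m = m - P.toLinearMap m (P.coroot i) • P.root i := by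
  rw [RootPairing.weylGroup.ofIdx_smul, RootPairing.Equiv.reflection_smul,
    RootPairing.reflection_apply]
  rfl

theorem ofIdx_smul_index (i j : ι) :
    RootPairing.weylGroup.ofIdx P i • j = P.reflectionPerm i j := by
  refine P.root.injective ?_
  rw [root_smul, RootPairing.weylGroup.ofIdx_smul, RootPairing.Equiv.reflection_smul,
    RootPairing.root_reflectionPerm]

/-- The action of the inverse of an element of the Weyl group on `V`. -/
noncomputable def dualSMul (w : P.weylGroup) : V →ₗ[ℂ] V := w.1.coweightMap

theorem pairing_smul (w : P.weylGroup) (m : M) (x : V) :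
    P.toLinearMap (w • m) x = P.toLinearMap m (dualSMul w x) :=
  LinearMap.congr_fun (w.1.toHom.weight_coweight_transpose_apply P P x) m

theorem dualSMul_mem_coweightLattice (w : P.weylGroup) {l : V} (hl : l ∈ coweightLattice P) :
    dualSMul w l ∈ coweightLattice P := by
  intro i
  obtain ⟨n, hn⟩ := hl (w • i)
  refine ⟨n, ?_⟩
  rw [← hn, RootPairing.root', RootPairing.root', ← pairing_smul, root_smul]

theorem coroot_mem_coweightLattice [P.IsCrystallographic] (i : ι) :
    P.coroot i ∈ coweightLattice P := by
  intro j
  obtain ⟨n, hn⟩ := P.exists_value (S := ℤ) j i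
  refine ⟨n, ?_⟩
  rw [RootPairing.root'_coroot_eq_pairing, ← hn]
  simp

/-- The roots span, so an element is determined by its permutation of the finitely many roots. -/
theorem finite_weylGroup [Finite ι] [P.IsRootSystem] : Finite P.weylGroup := by
  refine Finite.of_injective (β := Equiv.Perm ι) (fun w => w.1.indexEquiv) fun w w' h => ?_
  refine Subtype.ext (RootPairing.Equiv.weightHom_injective P ?_)
  refine LinearEquiv.toLinearMap_injective ?_
  refine LinearMap.ext_on (s := Set.range P.root) RootPairing.IsRootSystem.span_root_eq_top ?_
  rintro _ ⟨i, rfl⟩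
  have h1 : w • i = w' • i := congrFun (congrArg DFunLike.coe h) i
  have h2 := root_smul w i
  rw [h1, root_smul] at h2
  exact h2.symm

end RootSystems
-- Moving planes of the arrangement by affine transformations
section Transport

variable {ι M V : Type*} [AddCommGroup M] [Module ℂ M]
  [NormedAddCommGroup V] [NormedSpace ℂ V] {P : RootPairing ι ℂ M V}

/-- For a vector `v` regular with respect to the roots spanned by the set `S` of simple roots, some
element of the parabolic subgroup moves the simple roots in `S` into the half-space `v > 0`. -/
theorem exists_smul_rePairing_pos [Finite ι] [P.IsRootSystem] (b : P.Base) {S : Set ι}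
    (hS : S ⊆ b.support) (v : V) (hv : ∀ i ∈ spannedRoots P S, rePairing P v (P.root i) ≠ 0) :
    ∃ w : P.weylGroup, (∀ i, w • i ∈ spannedRoots P S ↔ i ∈ spannedRoots P S) ∧
      ∀ i ∈ S, 0 < rePairing P v (P.root (w • i)) := by
  obtain ⟨y, hy⟩ := exists_coroot'_eq b (fun _ => 1)
  -- Maximizing over the parabolic subgroup only, rather than the whole Weyl group, keeps the span
  -- of `S` invariant.
  let K : Subgroup P.weylGroup := Subgroup.closure (RootPairing.weylGroup.ofIdx P '' S)
  have hK : ∀ w ∈ K, ∀ m, w • m ∈ Submodule.span ℂ (P.root '' S) ↔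
      m ∈ Submodule.span ℂ (P.root '' S) := by
    intro w hw
    induction hw using Subgroup.closure_induction with
    | mem x hx =>
      obtain ⟨i, hi, rfl⟩ := hx
      intro m
      have h : P.toLinearMap m (P.coroot i) • P.root i ∈ Submodule.span ℂ (P.root '' S) :=
        Submodule.smul_mem _ _ (Submodule.subset_span (Set.mem_image_of_mem _ hi))
      rw [ofIdx_smul_eq, sub_eq_add_neg, Submodule.add_mem_iff_left _ (neg_mem h)]
    | one => simp
    | mul x y _ _ hx hy => intro m; rw [mul_smul, hx, hy]
    | inv x _ hx => intro m; rw [← hx, smul_inv_smul]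
  have := finite_weylGroup (P := P)
  obtain ⟨w, hw⟩ := Finite.exists_max fun w : K => rePairing P v (w.1 • y)
  refine ⟨w, fun i => ?_, fun i hi => ?_⟩
  · have h := hK w.1 w.2 (P.root i)
    rwa [← root_smul] at h
  · have h := hw (w * ⟨RootPairing.weylGroup.ofIdx P i,
      Subgroup.subset_closure (Set.mem_image_of_mem _ hi)⟩)
    simp only [Subgroup.coe_mul, mul_smul] at h
    rw [ofIdx_smul_eq, hy i (hS hi), one_smul, smul_sub, map_sub, ← root_smul] at h
    have h1 : w.1 • i ∈ spannedRoots P S := by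
      have h2 := hK w.1 w.2 (P.root i)
      rw [← root_smul] at h2
      exact h2.2 (Submodule.subset_span (Set.mem_image_of_mem _ hi))
    exact lt_of_le_of_ne (by linarith) (hv _ h1).symm

/-- If `μ` is a coweight in the closed antidominant alcove for the simple roots in `S`, whose
affine walls are the `[-θ, 1]` with `θ ∈ Θ`, then some element of the Weyl group maps `S` to the set
of finite and affine walls containing `μ`. -/
theorem exists_smul_mem_walls [Finite ι] [P.IsRootSystem] (b : P.Base) {S : Set ι}
    (hS : S ⊆ b.support) {μ : V} (hμ : μ ∈ coweightLattice P)
    (hSμ : ∀ i ∈ S, (P.root' i μ).re ≤ 0) (Θ : Set ι) (hΘS : Θ ⊆ spannedRoots P S)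
    (hΘ : ∀ i ∈ spannedRoots P S, ∃ θ ∈ Θ, P.root θ - P.root i ∈ AddSubmonoid.closure (P.root '' S))
    (hΘμ : ∀ θ ∈ Θ, -1 ≤ (P.root' θ μ).re) :
    ∃ w : P.weylGroup, ∀ i ∈ S, (w • i ∈ S ∧ P.root' (w • i) μ = 0) ∨
      ∃ θ ∈ Θ, P.root (w • i) = -P.root θ ∧ P.root' θ μ = -1 := by
  obtain ⟨ρ, hρ⟩ := exists_root'_eq b (fun _ => 1)
  -- With `N` larger than all heights, `f = h + N q` is ordered by the integer `q` first and by the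
  -- height second, so it is a regular perturbation of `N μ`.
  obtain ⟨N, hN⟩ : ∃ N : ℝ, ∀ i, |(b.height i : ℝ)| < N := by
    obtain ⟨N, hN⟩ := (Set.finite_range fun i => |(b.height i : ℝ)|).bddAbove
    exact ⟨N + 1, fun i => lt_of_le_of_lt (hN ⟨i, rfl⟩) (lt_add_one N)⟩
  let q : M →+ ℝ := rePairing P μ
  let h : M →+ ℝ := rePairing P ρ
  let f : M →+ ℝ := rePairing P (ρ + (N : ℂ) • μ)
  have hf (m : M) : f m = h m + N * q m := by
    simp only [f, h, q, rePairing_apply, map_add, map_smul, Complex.add_re, smul_eq_mul,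
      Complex.re_ofReal_mul]
  have hh (i : ι) : h (P.root i) = b.height i := rePairing_root b hρ i
  have hqn (i : ι) : ∃ n : ℤ, q (P.root i) = n ∧ P.root' i μ = n := by
    obtain ⟨n, hn⟩ := hμ i
    refine ⟨n, ?_, hn⟩
    have := congrArg Complex.re hn
    simpa using! this
  have hqS : ∀ x ∈ P.root '' S, q x ≤ 0 := by
    rintro _ ⟨i, hi, rfl⟩
    exact hSμ i hi
  have hq0 (m : M) (hm : m ∈ AddSubmonoid.closure (P.root '' S)) : q m ≤ 0 := by
    have := nonneg_of_mem_closure (-q) (fun x hx => by simpa using hqS x hx) hm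
    simpa using this
  have hh0 (m : M) (hm : m ∈ AddSubmonoid.closure (P.root '' S)) : 0 ≤ h m := by
    refine nonneg_of_mem_closure h ?_ hm
    rintro _ ⟨i, hi, rfl⟩
    rw [hh, b.height_one_of_mem_support (hS hi)]
    simp
  have hfq (i : ι) (hi : 0 < f (P.root i)) : 0 ≤ q (P.root i) := by
    obtain ⟨n, hn, -⟩ := hqn i
    by_contra hlt
    rw [not_le, hn] at hlt
    have h1 : (n : ℝ) ≤ -1 := by
      have : n < 0 := by exact_mod_cast hlt
      exact_mod_cast (by omega : n ≤ -1)
    rw [hf, hn, hh] at hi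
    have h2 := hN i
    have h3 := le_abs_self (b.height i : ℝ)
    have h4 := abs_nonneg (b.height i : ℝ)
    nlinarith
  -- The walls through `μ`. They generate the cone of the roots with `f > 0`: a positive such root
  -- has `q = 0` and lies on a face of the cone of `S`; for a negative one, `-α`, the root `α` lies
  -- below some `θ ∈ Θ`, the alcove inequality forces `q(θ) = -1`, and `-α = -θ + (θ - α)` with `q(θ
  -- - α) = 0`.
  let T : Set M := {x ∈ P.root '' S | q x = 0} ∪ {x | ∃ θ ∈ Θ, x = -P.root θ ∧ q (P.root θ) = -1}
  have hT (i : ι) (hi : i ∈ spannedRoots P S) (hfi : 0 < f (P.root i)) :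
      P.root i ∈ AddSubmonoid.closure T := by
    rcases mem_closure_or_neg_of_mem_spannedRoots b hS hi with hc | hc
    · have h0 : q (P.root i) = 0 := le_antisymm (hq0 _ hc) (hfq i hfi)
      exact AddSubmonoid.closure_mono Set.subset_union_left (mem_closure_ker_of_nonpos q hqS hc h0)
    · have hneg : P.reflectionPerm i i ∈ spannedRoots P S := by
        have : -P.root i ∈ Submodule.span ℂ (P.root '' S) := neg_mem hi
        simpa [spannedRoots] using this
      obtain ⟨θ, hθ, hθ2⟩ := hΘ _ hneg
      have hr : P.root (P.reflectionPerm i i) = -P.root i := by simp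
      rw [hr, sub_neg_eq_add] at hθ2
      have h1 := hh0 _ hc
      have h2 := hq0 _ hθ2
      have h3 : -1 ≤ q (P.root θ) := hΘμ θ hθ
      rw [map_add] at h2
      rw [map_neg] at h1
      obtain ⟨n, hn, -⟩ := hqn i
      have h4 : 0 < q (P.root i) := by
        refine lt_of_le_of_ne (hfq i hfi) fun h0 => ?_
        rw [hf, ← h0] at hfi
        linarith
      have h5 : 1 ≤ q (P.root i) := by
        rw [hn] at h4 ⊢
        have : 0 < n := by exact_mod_cast h4
        exact_mod_cast this
      have h6 : q (P.root θ + P.root i) = 0 := by rw [map_add]; linarith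
      have h7 := mem_closure_ker_of_nonpos q hqS hθ2 h6
      have h8 : P.root i = -P.root θ + (P.root θ + P.root i) := by abel
      rw [h8]
      exact add_mem (AddSubmonoid.subset_closure (Or.inr ⟨θ, hθ, rfl, by linarith⟩))
        (AddSubmonoid.closure_mono Set.subset_union_left h7)
  have hTr : ∀ x ∈ T, 0 < f x ∧ ∃ i ∈ spannedRoots P S, P.root i = x := by
    rintro x (⟨⟨i, hi, rfl⟩, h0⟩ | ⟨θ, hθ, rfl, h0⟩)
    · refine ⟨?_, i, Submodule.subset_span (Set.mem_image_of_mem _ hi), rfl⟩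
      rw [hf, h0, hh, b.height_one_of_mem_support (hS hi)]
      simp
    · refine ⟨?_, P.reflectionPerm θ θ, ?_, by simp⟩
      · have h1 := le_abs_self (b.height θ : ℝ)
        have h2 := hN θ
        rw [map_neg, hf, h0, hh]
        linarith
      · have : -P.root θ ∈ Submodule.span ℂ (P.root '' S) := neg_mem (hΘS hθ)
        simpa [spannedRoots] using this
  obtain ⟨w, hw, hwS⟩ := exists_smul_rePairing_pos b hS (ρ + (N : ℂ) • μ) (by
    intro i hi h0
    change f (P.root i) = 0 at h0
    have h1 : q (P.root i) = 0 := by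
      obtain ⟨n, hn, -⟩ := hqn i
      rw [hf, hh, hn] at h0
      by_contra hne
      rw [hn] at hne
      have h2 : (1 : ℝ) ≤ |(n : ℝ)| := by
        have : n ≠ 0 := by exact_mod_cast hne
        exact_mod_cast Int.one_le_abs this
      have h3 : |(b.height i : ℝ)| = N * |(n : ℝ)| := by
        rw [eq_neg_of_add_eq_zero_left h0, abs_neg, abs_mul,
          abs_of_pos (lt_of_le_of_lt (abs_nonneg _) (hN i))]
      have h4 := hN i
      have h5 := abs_nonneg (b.height i : ℝ)
      nlinarith
    rw [hf, h1, hh, mul_zero, add_zero] at h0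
    exact b.height_ne_zero i (by exact_mod_cast h0))
  have hnonneg (m : M) (hm : m ∈ AddSubmonoid.closure (P.root '' S)) : 0 ≤ f (w • m) := by
    refine nonneg_of_mem_closure (f.comp (DistribSMul.toAddMonoidHom M w)) ?_ hm
    rintro _ ⟨i, hi, rfl⟩
    have := (hwS i hi).le
    rwa [root_smul] at this
  refine ⟨w, fun i hi => ?_⟩
  have hspan : w • i ∈ spannedRoots P S :=
    (hw i).2 (Submodule.subset_span (Set.mem_image_of_mem _ hi))
  have hmem := hT _ hspan (hwS i hi)
  -- Pulled back by `w⁻¹`, the elements of `T` become positive roots, as `w S` generates the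
  -- `f`-positive roots. A simple root has height one, so it can be a sum of such roots only by
  -- being one of them.
  have hmem2 : P.root i ∈ AddSubmonoid.closure (DistribSMul.toAddMonoidHom M w⁻¹ '' T) := by
    rw [← AddMonoidHom.map_mclosure]
    refine ⟨_, hmem, ?_⟩
    rw [root_smul]
    exact inv_smul_smul w _
  have hmem3 := mem_of_mem_closure_of_height_eq_one h (by
    rintro _ ⟨x, hx, rfl⟩
    obtain ⟨hfx, j, hj, rfl⟩ := hTr x hx
    have hj' : w⁻¹ • j ∈ spannedRoots P S := (hw _).1 (by rwa [smul_inv_smul])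
    have hwj : DistribSMul.toAddMonoidHom M w⁻¹ (P.root j) = P.root (w⁻¹ • j) :=
      (root_smul _ _).symm
    rw [hwj, hh]
    have hc : P.root (w⁻¹ • j) ∈ AddSubmonoid.closure (P.root '' S) := by
      refine (mem_closure_or_neg_of_mem_spannedRoots b hS hj').resolve_right fun hc => ?_
      have := hnonneg _ hc
      rw [root_smul, smul_neg, smul_inv_smul, map_neg] at this
      linarith
    have hpos : b.IsPos (w⁻¹ • j) :=
      isPos_of_mem_closure b (fun k hk => b.isPos_of_mem_support (hS hk)) hc
    have hpos' : 1 ≤ b.height (w⁻¹ • j) := hpos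
    exact_mod_cast hpos') hmem2 (by rw [hh, b.height_one_of_mem_support (hS hi)]; simp)
  obtain ⟨x, hx, hxi⟩ := hmem3
  have hxw : x = P.root (w • i) := by
    rw [root_smul, ← hxi]
    exact (smul_inv_smul w x).symm
  rcases hx with ⟨⟨j, hj, hjx⟩, h0⟩ | ⟨θ, hθ, hθx, h0⟩
  · left
    have hjw : j = w • i := P.root.injective (hjx.trans hxw)
    subst hjw
    obtain ⟨n, hn, hn'⟩ := hqn (w • i)
    refine ⟨hj, ?_⟩
    rw [← hxw, h0] at hn
    rw [hn', Int.cast_eq_zero]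
    exact_mod_cast hn.symm
  · right
    refine ⟨θ, hθ, hxw.symm.trans hθx, ?_⟩
    obtain ⟨n, hn, hn'⟩ := hqn θ
    rw [h0] at hn
    have : n = -1 := by exact_mod_cast hn.symm
    rw [hn', this]
    simp

/-- A root of a root subsystem belongs to an irreducible component. -/
theorem exists_isIrreducibleComponent (P : RootPairing ι ℂ M V) (R₀ : Set ι) {i : ι} (hi : i ∈ R₀) :
    ∃ C, IsIrreducibleComponent P R₀ C ∧ i ∈ C := by
  -- The component of `i` consists of the roots reachable by chains of non-orthogonal roots.
  let r : ι → ι → Prop := fun j k => k ∈ R₀ ∧ P.pairing j k ≠ 0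
  have hmem : ∀ j, Relation.ReflTransGen r i j → j ∈ R₀ := by
    intro j hj
    cases hj with
    | refl => exact hi
    | tail _ h => exact h.1
  have hsymm (j k : ι) : P.pairing j k = 0 ↔ P.pairing k j = 0 := P.pairing_eq_zero_iff'
  refine ⟨{j | Relation.ReflTransGen r i j}, ⟨hmem, ⟨i, .refl⟩, ?_, ?_⟩, .refl⟩
  · rintro j hj k ⟨hk, hk'⟩
    by_contra h
    exact hk' (Relation.ReflTransGen.tail hj ⟨hk, h⟩)
  · rintro C' hC' ⟨j, hj⟩ horth
    have hstep : ∀ k l, k ∈ C' → r k l → l ∈ C' := by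
      intro k l hk hkl
      by_contra hl
      exact hkl.2 (horth k hk l ⟨Relation.ReflTransGen.tail (hC' hk) hkl, hl⟩)
    -- The subset `C'` need not contain `i` at the outset, so a chain from `i` to `j ∈ C'` is first
    -- traversed backwards, by symmetry of orthogonality.
    have hback : ∀ k l, k ∈ R₀ → l ∈ C' → r k l → k ∈ C' := by
      intro k l hk hl hkl
      exact hstep l k hl ⟨hk, fun h => hkl.2 ((hsymm l k).1 h)⟩
    have hiC : i ∈ C' := by
      have hij : Relation.ReflTransGen r i j := hC' hj
      clear horth
      induction hij with
      | refl => exact hj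
      | tail hab hbc ih => exact ih (hback _ _ (hmem _ hab) hj hbc)
    refine Set.Subset.antisymm hC' fun k hk => ?_
    have hik : Relation.ReflTransGen r i k := hk
    induction hik with
    | refl => exact hiC
    | tail hab hbc ih => exact hstep _ _ (ih hab) hbc

/-- Positivity of the affine root `[α, ħ k]`. -/
def IsAffinePos (b : P.Base) (β : ι × ℤ) : Prop := 0 < β.2 ∨ β.2 = 0 ∧ b.IsPos β.1

/-- The maximal roots of the irreducible components of `R₀`, in so far as their generalized Coxeter
number is `ħ`. -/
def componentMaximalRoots (P : RootPairing ι ℂ M V) (η : ι → ℂ) (S : Set ι) (ħ : ℂ) : Set ι :=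
  {θ | ∃ C, IsIrreducibleComponent P (spannedRoots P S) C ∧ IsMaximalRoot P (S ∩ C) C θ ∧
    ∃ n : ι →₀ ℕ, (n.support : Set ι) ⊆ S ∧ P.root θ = n.sum (fun j m => m • P.root j) ∧
      ħ = η θ + n.sum (fun j m => m • η j)}

theorem exists_componentMaximalRoot {η : ι → ℂ} {S : Set ι} {ħ : ℂ}
    (hcox : ∀ C : Set ι, IsIrreducibleComponent P (spannedRoots P S) C →
      IsGenCoxeterNumber P η (S ∩ C) C ħ) {i : ι} (hi : i ∈ spannedRoots P S) :
    ∃ θ ∈ componentMaximalRoots P η S ħ,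
      P.root θ - P.root i ∈ AddSubmonoid.closure (P.root '' S) := by
  obtain ⟨C, hC, hiC⟩ := exists_isIrreducibleComponent P _ hi
  obtain ⟨θ, n, hθ, hn, h1, h2⟩ := hcox C hC
  exact ⟨θ, ⟨C, hC, hθ, n, hn.trans Set.inter_subset_left, h1, h2⟩,
    AddSubmonoid.closure_mono (Set.image_mono Set.inter_subset_left) (hθ.2 i hiC)⟩

theorem componentMaximalRoots_subset {η : ι → ℂ} {S : Set ι} {ħ : ℂ} :
    componentMaximalRoots P η S ħ ⊆ spannedRoots P S := by
  rintro θ ⟨C, hC, hθ, -⟩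
  exact hC.subset hθ.1

theorem root_mem_closure_of_mem_componentMaximalRoots {η : ι → ℂ} {S : Set ι} {ħ : ℂ} {θ : ι}
    (hθ : θ ∈ componentMaximalRoots P η S ħ) : P.root θ ∈ AddSubmonoid.closure (P.root '' S) := by
  obtain ⟨C, -, -, n, hn, h, -⟩ := hθ
  rw [h]
  exact sum_mem fun j hj => nsmul_mem (AddSubmonoid.subset_closure (Set.mem_image_of_mem _ (hn hj))) _

/-- The value of `w θ` on the plane `H_η(w S)`. -/
theorem root'_smul_componentMaximalRoot {η : ι → ℂ}
    (hη : ∀ (w : P.weylGroup) (i : ι), η (w • i) = η i) {S : Set ι} {ħ : ℂ} {θ : ι}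
    (hθ : θ ∈ componentMaximalRoots P η S ħ) (w : P.weylGroup) {x : V}
    (hx : x ∈ plane P η ((fun i => w • i) '' S)) : P.root' (w • θ) x = ħ - η θ := by
  obtain ⟨C, -, -, n, hn, h, h2⟩ := hθ
  rw [h2, add_sub_cancel_left, RootPairing.root', root_smul, pairing_smul, h, Finsupp.sum, map_sum,
    LinearMap.sum_apply]
  refine Finset.sum_congr rfl fun j hj => ?_
  rw [map_nsmul, LinearMap.smul_apply, ← pairing_smul, ← root_smul, ← RootPairing.root',
    hx _ (Set.mem_image_of_mem _ (hn hj)), hη]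

/-- The affine transformation `g` is the composition of the translation by `ħ μ` and the element `u`
of the Weyl group. -/
def IsAffineWeyl (P : RootPairing ι ℂ M V) (ħ : ℂ) (g : V → V) (u : P.weylGroup) (μ : V) : Prop :=
  μ ∈ coweightLattice P ∧ ∀ (m : M) (x : V), P.toLinearMap (u • m) (g x) = P.toLinearMap m (x + ħ • μ)

/-- The affine simple roots of `w R₀`. -/
def movedAffineSimple (P : RootPairing ι ℂ M V) (η : ι → ℂ) (S : Set ι) (ħ : ℂ) (w : P.weylGroup) :
    Set (ι × ℤ) :=
  (fun i => (w • i, 0)) '' S ∪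
    (fun θ => (P.reflectionPerm (w • θ) (w • θ), 1)) '' componentMaximalRoots P η S ħ

theorem eta_reflectionPerm {η : ι → ℂ} (hη : ∀ (w : P.weylGroup) (i : ι), η (w • i) = η i) (i j : ι) :
    η (P.reflectionPerm i j) = η j := by
  rw [← ofIdx_smul_index, hη]

/-- On the plane `wθ` equals `ħ - η_θ` by the Coxeter number condition, so `[-wθ, ħ]` equals `η_θ`;
this puts it on the same footing as the finite simple roots. -/
theorem affRoot_eq_of_mem_movedAffineSimple {η : ι → ℂ}
    (hη : ∀ (w : P.weylGroup) (i : ι), η (w • i) = η i) {S : Set ι} {ħ : ℂ} {w : P.weylGroup}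
    {β : ι × ℤ} (hβ : β ∈ movedAffineSimple P η S ħ w) {x : V}
    (hx : x ∈ plane P η ((fun i => w • i) '' S)) : affRoot P ħ β x = η β.1 := by
  rcases hβ with ⟨i, hi, rfl⟩ | ⟨θ, hθ, rfl⟩
  · rw [affRoot_apply, hx _ (Set.mem_image_of_mem _ hi)]
    simp
  · rw [affRoot_apply, eta_reflectionPerm hη, hη, RootPairing.root', RootPairing.root_reflectionPerm,
      RootPairing.reflection_apply_self, map_neg, LinearMap.neg_apply, ← RootPairing.root',
      root'_smul_componentMaximalRoot hη hθ w hx]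
    simp

/-- An affine transformation moving the affine simple roots of `w R₀` to positive affine roots
moves the plane `H_η(w S₀)` into the arrangement. -/
theorem apply_mem_arrangement [Finite ι] [P.IsRootSystem] (b : P.Base) {η : ι → ℂ}
    (hη : ∀ (w : P.weylGroup) (i : ι), η (w • i) = η i) {S : Set ι} (hS : S ⊆ b.support) {ħ : ℂ}
    (hcox : ∀ C : Set ι, IsIrreducibleComponent P (spannedRoots P S) C →
      IsGenCoxeterNumber P η (S ∩ C) C ħ)
    {g : V → V} {u : P.weylGroup} {μ : V} (hg : IsAffineWeyl P ħ g u μ) (w : P.weylGroup)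
    (hpos : ∀ β ∈ movedAffineSimple P η S ħ w, ∀ n : ℤ, P.root' β.1 μ = n →
      IsAffinePos b (u • β.1, β.2 - n))
    {x : V} (hx : x ∈ plane P η ((fun i => w • i) '' S)) : g x ∈ arrangement b η S := by
  have hdual (i : ι) : P.root' i (dualSMul w μ) = P.root' (w • i) μ := by
    rw [RootPairing.root', RootPairing.root', root_smul, pairing_smul]
  have hneg (i : ι) : P.root (P.reflectionPerm i i) = -P.root i := by simp
  have hroot (i : ι) : P.root' (u • w • i) (g x) = P.root' (w • i) x + ħ * P.root' (w • i) μ := by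
    rw [RootPairing.root', root_smul, hg.2, map_add, LinearMap.map_smul, smul_eq_mul]
  -- A positive affine root has non-negative level. Applied to the images of `[wα, 0]` and `[-wθ,
  -- ħ]`, this says that `w⁻¹μ` lies in the closed antidominant alcove.
  obtain ⟨v, hv⟩ := exists_smul_mem_walls b hS (dualSMul_mem_coweightLattice w hg.1) (by
    intro i hi
    obtain ⟨n, hn⟩ := hg.1 (w • i)
    have h := hpos _ (Or.inl (Set.mem_image_of_mem _ hi)) n hn
    rw [hdual, hn, Complex.intCast_re]
    have : n ≤ 0 := by
      rcases h with h | h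
      · simp only at h; omega
      · have := h.1; simp only at this; omega
    exact_mod_cast this) (componentMaximalRoots P η S ħ) componentMaximalRoots_subset
    (fun i hi => exists_componentMaximalRoot hcox hi) (by
    intro θ hθ
    obtain ⟨n, hn⟩ := hg.1 (P.reflectionPerm (w • θ) (w • θ))
    have h := hpos _ (Or.inr (Set.mem_image_of_mem _ hθ)) n hn
    rw [RootPairing.root', hneg, map_neg, LinearMap.neg_apply, neg_eq_iff_eq_neg] at hn
    rw [hdual, hn, Complex.neg_re, Complex.intCast_re]
    have : n ≤ 1 := by
      rcases h with h | h
      · simp only at h; omega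
      · have := h.1; simp only at this; omega
    have h2 : (n : ℝ) ≤ 1 := by exact_mod_cast this
    linarith)
  -- Being a wall through `w⁻¹μ` means that the image under `g` has level zero: its affine
  -- positivity is then positivity of the gradient, and its value at `g x` is the `η`-value of the
  -- original affine root at `x`.
  have key : ∀ i ∈ S, b.IsPos (u • w • v • i) ∧ P.root' (u • w • v • i) (g x) = η i := by
    intro i hi
    rcases hv i hi with ⟨h1, h2⟩ | ⟨θ, hθ, h1, h2⟩
    · rw [hdual] at h2
      constructor
      · have h := hpos _ (Or.inl (Set.mem_image_of_mem _ h1)) 0 (by rw [h2]; simp)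
        rcases h with h | h
        · simp at h
        · exact h.2
      · rw [hroot, h2, hx _ (Set.mem_image_of_mem _ h1), hη, hη]
        simp
    · rw [hdual] at h2
      have h3 : w • v • i = P.reflectionPerm (w • θ) (w • θ) := by
        refine P.root.injective ?_
        rw [hneg, root_smul, h1, root_smul, smul_neg]
      have h4 : P.root' (w • v • i) μ = 1 := by
        rw [h3, RootPairing.root', hneg, map_neg, LinearMap.neg_apply, ← RootPairing.root', h2,
          neg_neg]
      constructor
      · have h := hpos _ (Or.inr (Set.mem_image_of_mem _ hθ)) 1 (by rw [← h3, h4]; simp)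
        simp only [← h3] at h
        rcases h with h | h
        · simp at h
        · exact h.2
      · have h5 : η θ = η i := by
          rw [← hη (w * v) i, mul_smul, h3, eta_reflectionPerm hη, hη]
        rw [hroot, h4, h3, RootPairing.root', hneg, map_neg, LinearMap.neg_apply,
          ← RootPairing.root', root'_smul_componentMaximalRoot hη hθ w hx, h5]
        ring
  refine Set.mem_iUnion₂.2 ⟨u * w * v, fun i hi => ?_, ?_⟩
  · rw [mul_smul, mul_smul]
    exact (key i hi).1
  · rintro _ ⟨i, hi, rfl⟩
    simp only [mul_smul, hη]
    exact (key i hi).2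

end Transport
-- Normal forms of affine transformations and vanishing criteria for `T_β f`
section Operators

variable {ι M V : Type*} [AddCommGroup M] [Module ℂ M]
  [NormedAddCommGroup V] [NormedSpace ℂ V] {P : RootPairing ι ℂ M V}

theorem root_reflectionPerm_self (i : ι) : P.root (P.reflectionPerm i i) = -P.root i := by simp

/-- The reflection in `[α, ħk]` is translation by `ħ k α^∨` followed by `s_α`. -/
theorem isAffineWeyl_affRefl [P.IsCrystallographic] (ħ : ℂ) (β : ι × ℤ) :
    IsAffineWeyl P ħ (affRefl P ħ β) (RootPairing.weylGroup.ofIdx P β.1)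
      ((β.2 : ℂ) • P.coroot β.1) := by
  refine ⟨?_, fun m x => ?_⟩
  · rw [Int.cast_smul_eq_zsmul]
    exact zsmul_mem (coroot_mem_coweightLattice _) _
  · rw [ofIdx_smul_eq, affRefl_apply, affRoot_apply]
    simp only [map_sub, map_add, LinearMap.map_smul, LinearMap.sub_apply, LinearMap.smul_apply,
      smul_eq_mul, RootPairing.root', RootPairing.root_coroot_eq_pairing,
      RootPairing.pairing_same]
    ring

theorem isAffineWeyl_one (ħ : ℂ) : IsAffineWeyl P ħ (1 : V ≃ᵃ[ℂ] V) 1 0 :=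
  ⟨zero_mem _, fun m x => by simp⟩

/-- Moving a translation past a Weyl element: `u τ(μ) u' τ(μ') = u u' τ(u'⁻¹μ + μ')`. -/
theorem IsAffineWeyl.mul {ħ : ℂ} {g g' : V ≃ᵃ[ℂ] V} {u u' : P.weylGroup} {μ μ' : V}
    (h : IsAffineWeyl P ħ g u μ) (h' : IsAffineWeyl P ħ g' u' μ') :
    IsAffineWeyl P ħ (g * g' : V ≃ᵃ[ℂ] V) (u * u') (μ' + dualSMul u' μ) := by
  refine ⟨add_mem h'.1 (dualSMul_mem_coweightLattice _ h.1), fun m x => ?_⟩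
  rw [mul_smul, AffineEquiv.mul_def, AffineEquiv.trans_apply, h.2, map_add, h'.2]
  simp only [map_add, LinearMap.map_smul, smul_add, pairing_smul]
  ring

theorem isAffineWeyl_coreflection (ħ : ℂ) (i : ι) :
    IsAffineWeyl P ħ (P.coreflection i).toAffineEquiv (RootPairing.weylGroup.ofIdx P i) 0 := by
  refine ⟨zero_mem _, fun m x => ?_⟩
  rw [ofIdx_smul_eq, LinearEquiv.coe_toAffineEquiv, RootPairing.coreflection_apply]
  simp only [map_sub, LinearMap.map_smul, LinearMap.sub_apply, LinearMap.smul_apply,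
    smul_eq_mul, RootPairing.root', RootPairing.root_coroot_eq_pairing,
    RootPairing.pairing_same, smul_zero, add_zero]
  ring

theorem isAffineWeyl_constVAdd (ħ : ℂ) {l : V} (hl : l ∈ coweightLattice P) :
    IsAffineWeyl P ħ (AffineEquiv.constVAdd ℂ V (ħ • l)) 1 l := by
  refine ⟨hl, fun m x => ?_⟩
  rw [one_smul, AffineEquiv.constVAdd_apply, vadd_eq_add, add_comm]

theorem exists_isAffineWeyl {ħ : ℂ} {g : V ≃ᵃ[ℂ] V} (hg : g ∈ extAffineWeylGroup P ħ) :
    ∃ u μ, IsAffineWeyl P ħ g u μ := by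
  refine Subgroup.closure_induction'' (p := fun (g : V ≃ᵃ[ℂ] V) _ => ∃ u μ, IsAffineWeyl P ħ g u μ) ?_ ?_ ?_ ?_ hg
  · rintro _ (⟨i, rfl⟩ | ⟨l, hl, rfl⟩)
    · exact ⟨_, _, isAffineWeyl_coreflection ħ i⟩
    · exact ⟨_, _, isAffineWeyl_constVAdd ħ hl⟩
  · rintro _ (⟨i, rfl⟩ | ⟨l, hl, rfl⟩)
    · have h : ((P.coreflection i).toAffineEquiv)⁻¹ = (P.coreflection i).toAffineEquiv := by
        rw [inv_eq_iff_mul_eq_one]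
        ext x
        exact Module.involutive_reflection (P.flip.coroot_root_two i) x
      exact ⟨_, _, h ▸ isAffineWeyl_coreflection ħ i⟩
    · have h : (AffineEquiv.constVAdd ℂ V (ħ • l))⁻¹ = AffineEquiv.constVAdd ℂ V (ħ • -l) := by
        rw [smul_neg]
        exact AffineEquiv.constVAdd_symm ℂ V (ħ • l)
      refine ⟨1, -l, ?_⟩
      simp only [h]
      exact isAffineWeyl_constVAdd ħ (neg_mem hl)
  · exact ⟨_, _, isAffineWeyl_one ħ⟩
  · rintro _ _ _ _ ⟨_, _, h⟩ ⟨_, _, h'⟩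
    exact ⟨_, _, h.mul h'⟩

/-- A fundamental coweight works for a simple root, and reflections, which preserve the coweight
lattice, carry it to all roots. -/
theorem exists_coweight_root'_eq_one [Finite ι] [P.IsRootSystem] [P.IsCrystallographic]
    [P.IsReduced] (b : P.Base) (i : ι) : ∃ l ∈ coweightLattice P, P.root' i l = 1 := by
  classical
  refine b.induction_reflect i (p := fun i => ∃ l ∈ coweightLattice P, P.root' i l = 1) ?_ ?_ ?_
  · rintro i ⟨l, hl, h⟩
    refine ⟨-l, neg_mem hl, ?_⟩
    rw [RootPairing.root', root_reflectionPerm_self, map_neg P.toLinearMap, LinearMap.neg_apply, map_neg, neg_neg]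
    exact h
  · intro i hi
    obtain ⟨l, hl⟩ := exists_root'_eq b (Pi.single i 1)
    refine ⟨l, fun j => ?_, by rw [hl i hi, Pi.single_eq_same]⟩
    have h : ∀ m ∈ Submodule.span ℤ (P.root '' (b.support : Set ι)),
        ∃ n : ℤ, P.toLinearMap m l = n := by
      intro m hm
      induction hm using Submodule.span_induction with
      | mem x hx =>
        obtain ⟨k, hk, rfl⟩ := hx
        refine ⟨if k = i then 1 else 0, ?_⟩
        rw [← RootPairing.root', hl k hk, Pi.single_apply]
        split_ifs <;> simp
      | zero => exact ⟨0, by simp⟩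
      | add x y _ _ hx hy =>
        obtain ⟨m, hm⟩ := hx
        obtain ⟨n, hn⟩ := hy
        exact ⟨m + n, by rw [map_add, LinearMap.add_apply, hm, hn, Int.cast_add]⟩
      | smul c x _ hx =>
        obtain ⟨m, hm⟩ := hx
        exact ⟨c * m, by rw [map_zsmul, LinearMap.smul_apply, hm]; simp⟩
    exact h _ (b.root_mem_span_int j)
  · rintro i j ⟨l, hl, h⟩ -
    refine ⟨P.coreflection j l, ?_, ?_⟩
    · rw [RootPairing.coreflection_apply]
      obtain ⟨n, hn⟩ := hl j
      rw [hn, Int.cast_smul_eq_zsmul]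
      exact sub_mem hl (zsmul_mem (coroot_mem_coweightLattice j) n)
    · have h2 := (isAffineWeyl_coreflection (P := P) 0 j).2 (P.root i) l
      rw [← root_smul, ofIdx_smul_index, zero_smul, add_zero] at h2
      exact h2.trans h

/-- Translation by a multiple of a coweight pairing to 1 with the root reaches every level, so
invariance makes `t` independent of the level. -/
theorem eq_of_translation_invariant [Finite ι] [P.IsRootSystem] [P.IsCrystallographic]
    [P.IsReduced] (b : P.Base) {ħ : ℂ} {t : ι × ℤ → ℂˣ}
    (ht : ∀ w ∈ extAffineWeylGroup P ħ, ∀ β γ : ι × ℤ,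
      affRoot P ħ γ = actFunctional w (affRoot P ħ β) → t γ = t β) (i : ι) (k : ℤ) :
    t (i, k) = t (i, 0) := by
  obtain ⟨l, hl, h⟩ := exists_coweight_root'_eq_one b i
  refine ht (AffineEquiv.constVAdd ℂ V (ħ • (-k) • l))
    (Subgroup.subset_closure (Or.inr ⟨(-k) • l, zsmul_mem hl _, rfl⟩)) _ _ ?_
  ext x
  have h2 : actFunctional (AffineEquiv.constVAdd ℂ V (ħ • (-k) • l)) (affRoot P ħ (i, 0)) x
      = affRoot P ħ (i, 0) (-(ħ • (-k) • l) + x) := rfl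
  rw [h2, affRoot_apply, affRoot_apply]
  simp only [map_add, map_neg, LinearMap.map_smul, map_zsmul, h, smul_eq_mul, zsmul_eq_mul]
  push_cast
  ring

/-- If `β` is not constant on a plane on which both `f` and `s_β f` vanish, then `T_β f` vanishes on
this plane. -/
theorem opT_apply_eq_zero_of_notMem_span [FiniteDimensional ℂ V] [P.IsCrystallographic] (ħ : ℂ)
    (β : ι × ℤ) (τ : ℂˣ) (f : periodicFunctions P) {η : ι → ℂ} {S : Set ι}
    (hβ : P.root β.1 ∉ Submodule.span ℂ (P.root '' S))
    (h : ∀ y ∈ plane P η S, f.1 y = 0 ∧ f.1 (affRefl P ħ β y) = 0) {x : V} (hx : x ∈ plane P η S) :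
    (opT P ħ β τ f).1 x = 0 := by
  -- A direction `d` along the plane in which `β` is not constant. On the line `x + z d` the
  -- function `e^{-β}` has non-zero derivative at `z = 0`, so nearby points with `z ≠ 0` avoid the
  -- poles; there the explicit formula gives 0, and continuity gives the value at `x`.
  obtain ⟨φ, hφ, hφS⟩ := Submodule.exists_le_ker_of_notMem hβ
  obtain ⟨d, rfl⟩ := P.flip.toPerfPair.surjective φ
  have hd : P.root' β.1 d ≠ 0 := hφ
  have hdS : ∀ i ∈ S, P.root' i d = 0 := fun i hi =>
    LinearMap.mem_ker.1 (hφS (Submodule.subset_span (Set.mem_image_of_mem _ hi)))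
  have hline (z : ℂ) : x + z • d ∈ plane P η S := by
    intro i hi
    rw [map_add, map_smul, hdS i hi, hx i hi, smul_zero, add_zero]
  have haff (z : ℂ) : affRoot P ħ β (x + z • d) = affRoot P ħ β x + z * P.root' β.1 d := by
    rw [affRoot_apply, affRoot_apply, map_add, map_smul, smul_eq_mul]
    ring
  let F : ℂ → ℂ := fun z => (opT P ħ β τ f).1 (x + z • d)
  have hF : Continuous F := (opT P ħ β τ f).2.1.continuous.comp (by fun_prop)
  let E : ℂ → ℂ := fun z => Complex.exp (-affRoot P ħ β (x + z • d))
  have hE : HasDerivAt E (Complex.exp (-affRoot P ħ β x) * -P.root' β.1 d) 0 := by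
    have h1 : HasDerivAt (fun z => -(affRoot P ħ β x + z * P.root' β.1 d)) (-P.root' β.1 d) 0 := by
      have h := (((hasDerivAt_id (0 : ℂ)).mul_const (P.root' β.1 d)).const_add
        (affRoot P ħ β x)).neg
      rwa [one_mul] at h
    have h2 := h1.cexp
    simp only [E, haff]
    simpa using h2
  have hne : ∀ᶠ z in 𝓝[≠] (0 : ℂ), E z ≠ 1 :=
    hE.eventually_ne (mul_ne_zero (Complex.exp_ne_zero _) (neg_ne_zero.2 hd))
  have hF0 : ∀ᶠ z in 𝓝[≠] (0 : ℂ), F z = 0 := by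
    filter_upwards [hne] with z hz
    obtain ⟨h1, h2⟩ := h _ (hline z)
    simp only [F]
    rw [opT_apply P ħ β τ f _ hz, h1, h2, mul_zero, mul_zero, add_zero]
  have hlim : Filter.Tendsto F (𝓝[≠] 0) (𝓝 (F 0)) := hF.continuousAt.mono_left nhdsWithin_le_nhds
  have h0 : F 0 = 0 := tendsto_nhds_unique hlim (tendsto_const_nhds.congr' (hF0.mono fun _ h => h.symm))
  simpa [F] using h0

/-- The hypothesis on `τ` kills the coefficient `τ⁻¹ - τ e^{-β}` of the divided difference, so no
information on `f` off the point `x` is needed. -/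
theorem opT_apply_eq_zero_of_affRoot_eq [FiniteDimensional ℂ V] [P.IsCrystallographic] (ħ : ℂ)
    (β : ι × ℤ) (τ : ℂˣ) (f : periodicFunctions P) {x : V}
    (hτ : (τ : ℂ) ^ 2 = Complex.exp (affRoot P ħ β x)) (hf : f.1 x = 0) :
    (opT P ħ β τ f).1 x = 0 := by
  change (τ : ℂ) * f.1 x -
    ((τ : ℂ)⁻¹ - (τ : ℂ) * Complex.exp (-affRoot P ħ β x)) * divDiff P ħ β f.1 x = 0
  have h0 : (τ : ℂ) ≠ 0 := τ.ne_zero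
  rw [hf, Complex.exp_neg, ← hτ]
  field_simp
  ring

/-! ### Simple affine reflections -/

theorem smul_mem_closure {w : P.weylGroup} {S : Set ι} {m : M}
    (hm : m ∈ AddSubmonoid.closure (P.root '' S)) :
    w • m ∈ AddSubmonoid.closure (P.root '' ((fun i => w • i) '' S)) := by
  have h := AddSubmonoid.mem_map_of_mem (DistribSMul.toAddMonoidHom M w) hm
  rw [AddMonoidHom.map_mclosure, Set.image_image] at h
  rw [Set.image_image]
  simp only [root_smul]
  exact h

theorem isPos_smul_componentMaximalRoot [P.IsRootSystem] (b : P.Base) {η : ι → ℂ} {S : Set ι} {ħ : ℂ}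
    {w : P.weylGroup} (hw : w ∈ weylPlus b S) {θ : ι} (hθ : θ ∈ componentMaximalRoots P η S ħ) :
    b.IsPos (w • θ) := by
  refine isPos_of_mem_closure b (S := (fun i => w • i) '' S) ?_ ?_
  · rintro _ ⟨i, hi, rfl⟩
    exact hw i hi
  · rw [root_smul]
    exact smul_mem_closure (root_mem_closure_of_mem_componentMaximalRoots hθ)

theorem inv_smul_mem_spannedRoots {w : P.weylGroup} {S : Set ι} {i : ι}
    (hi : i ∈ spannedRoots P ((fun i => w • i) '' S)) : w⁻¹ • i ∈ spannedRoots P S := by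
  have key : ∀ m ∈ Submodule.span ℂ (P.root '' ((fun i => w • i) '' S)),
      w⁻¹ • m ∈ Submodule.span ℂ (P.root '' S) := by
    intro m hm
    induction hm using Submodule.span_induction with
    | mem x hx =>
      obtain ⟨_, ⟨i, hi, rfl⟩, rfl⟩ := hx
      rw [root_smul, inv_smul_smul]
      exact Submodule.subset_span (Set.mem_image_of_mem _ hi)
    | zero => rw [smul_zero]; exact zero_mem _
    | add x y _ _ hx hy => rw [smul_add]; exact add_mem hx hy
    | smul c x _ hx =>
      have : w⁻¹ • c • x = c • w⁻¹ • x := smul_comm (w⁻¹).1 c x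
      rw [this]
      exact Submodule.smul_mem _ _ hx
  have h := key _ hi
  rwa [← root_smul] at h

/-- The generators of the cone have height one, so the only element of the cone of height zero is 0.
-/
theorem le_height_of_mem_closure [P.IsRootSystem] (b : P.Base) {i j : ι}
    (h : P.root i - P.root j ∈ AddSubmonoid.closure (P.root '' (b.support : Set ι))) :
    b.height j ≤ b.height i ∧ (b.height i ≤ b.height j → i = j) := by
  obtain ⟨ρ, hρ⟩ := exists_root'_eq b (fun _ => 1)
  have h1 : ∀ x ∈ P.root '' (b.support : Set ι), 1 ≤ rePairing P ρ x := by
    rintro _ ⟨k, hk, rfl⟩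
    rw [rePairing_root b hρ, b.height_one_of_mem_support hk]
    simp
  have h2 := nonneg_of_mem_closure _ (fun x hx => zero_le_one.trans (h1 x hx)) h
  rw [map_sub, rePairing_root b hρ, rePairing_root b hρ] at h2
  refine ⟨by exact_mod_cast sub_nonneg.1 h2, fun h3 => ?_⟩
  have h4 : (b.height i : ℝ) ≤ b.height j := by exact_mod_cast h3
  have h5 := mem_closure_ker_of_nonpos (-rePairing P ρ)
    (fun x hx => by
      have := h1 x hx
      simp only [AddMonoidHom.neg_apply]
      linarith) h (by
      rw [AddMonoidHom.neg_apply, map_sub, rePairing_root b hρ, rePairing_root b hρ]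
      linarith)
  have h6 : {x ∈ P.root '' (b.support : Set ι) | (-rePairing P ρ) x = 0} = ∅ := by
    refine Set.eq_empty_of_forall_notMem fun x hx => ?_
    have h7 := h1 x hx.1
    have h8 := hx.2
    simp only [AddMonoidHom.neg_apply] at h8
    linarith
  rw [h6, AddSubmonoid.closure_empty, AddSubmonoid.mem_bot, sub_eq_zero] at h5
  exact P.root.injective h5

/-- If an affine simple root is constant on the plane `H_η(w S₀)`, then it is an affine simple
root of `w R₀`. -/
theorem affSimple_mem_movedAffineSimple [P.IsRootSystem] (b : P.Base) {θ : ι}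
    (hθ : IsMaximalRoot P (b.support : Set ι) Set.univ θ) {η : ι → ℂ} {S : Set ι}
    (hS : S ⊆ b.support) {ħ : ℂ}
    (hcox : ∀ C : Set ι, IsIrreducibleComponent P (spannedRoots P S) C →
      IsGenCoxeterNumber P η (S ∩ C) C ħ)
    {w : P.weylGroup} (hw : w ∈ weylPlus b S) (j : Option b.support)
    (hj : (affSimple b θ j).1 ∈ spannedRoots P ((fun i => w • i) '' S)) :
    affSimple b θ j ∈ movedAffineSimple P η S ħ w := by
  have hwS : ∀ i ∈ (fun i => w • i) '' S, b.IsPos i := by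
    rintro _ ⟨i, hi, rfl⟩
    exact hw i hi
  cases j with
  | some i =>
    have hi := inv_smul_mem_spannedRoots hj
    left
    have hipos := b.isPos_of_mem_support i.2
    -- The opposite sign is impossible, because `wS₀` consists of positive roots and `α_i` is
    -- positive.
    have hc : P.root (i : ι) ∈ AddSubmonoid.closure (P.root '' ((fun i => w • i) '' S)) := by
      rcases mem_closure_or_neg_of_mem_spannedRoots b hS hi with h | h
      · have h2 := smul_mem_closure (w := w) h
        rwa [← root_smul, smul_inv_smul] at h2
      · have h2 := smul_mem_closure (w := w) h
        rw [smul_neg, ← root_smul, smul_inv_smul, ← root_reflectionPerm_self] at h2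
        exact absurd hipos ((RootPairing.Base.IsPos.neg_iff_not b (i : ι)).1
          (isPos_of_mem_closure b hwS h2))
    obtain ⟨ρ, hρ⟩ := exists_root'_eq b (fun _ => 1)
    obtain ⟨_, ⟨k, hk, rfl⟩, hki⟩ := mem_of_mem_closure_of_height_eq_one (rePairing P ρ) (by
      rintro _ ⟨k, hk, rfl⟩
      rw [rePairing_root b hρ]
      have h : 1 ≤ b.height k := hwS k hk
      exact_mod_cast h) hc (by
      rw [rePairing_root b hρ, b.height_one_of_mem_support i.2]
      simp)
    exact ⟨k, hk, Prod.ext (P.root.injective hki) rfl⟩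
  | none =>
    right
    have hj' : θ ∈ spannedRoots P ((fun i => w • i) '' S) := by
      have h : P.root (P.reflectionPerm θ θ) ∈ Submodule.span ℂ (P.root '' ((fun i => w • i) '' S)) :=
        hj
      rw [root_reflectionPerm_self, neg_mem_iff] at h
      exact h
    -- The root `wc` dominates `θ`, since `w` maps the cone of `S₀` into the positive cone;
    -- maximality of `θ` then forces `θ = wc`.
    obtain ⟨c, hc, hc2⟩ := exists_componentMaximalRoot hcox (inv_smul_mem_spannedRoots hj')
    have h2 := smul_mem_closure (w := w) hc2
    rw [smul_sub, ← root_smul, ← root_smul, smul_inv_smul] at h2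
    have h3 : P.root (w • c) - P.root θ ∈ AddSubmonoid.closure (P.root '' (b.support : Set ι)) := by
      refine AddSubmonoid.closure_le.2 ?_ h2
      rintro _ ⟨k, hk, rfl⟩
      exact (isPos_iff_mem_closure b k).1 (hwS k hk)
    have h4 := le_height_of_mem_closure b (hθ.2 (w • c) trivial)
    have h5 : θ = w • c := h4.2 (le_height_of_mem_closure b h3).1
    refine ⟨c, hc, ?_⟩
    simp only [← h5]
    rfl

/-- A height estimate suffices: with `p = ⟨α, θ^∨⟩`, the root `s_θ α = α - pθ` and its negative have
height at most that of `θ`. This excludes `p < 0`, and for `p ≥ 2` it gives `α` at least the height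
of `θ`, hence `α = θ`. -/
theorem pairing_maximalRoot [P.IsRootSystem] [P.IsCrystallographic] (b : P.Base) {θ : ι}
    (hθ : IsMaximalRoot P (b.support : Set ι) Set.univ θ) {i : ι} (hi : b.IsPos i) :
    0 ≤ P.pairingIn ℤ i θ ∧ (i ≠ θ → P.pairingIn ℤ i θ ≤ 1) := by
  have hle (j : ι) := (le_height_of_mem_closure b (hθ.2 j trivial)).1
  have hs : P.root (P.reflectionPerm θ i) = P.root i + (-P.pairingIn ℤ i θ) • P.root θ := by
    rw [RootPairing.root_reflectionPerm, neg_smul, RootPairing.reflection_apply_root' ℤ,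
      sub_eq_add_neg]
  have hh := b.height_add_zsmul hs
  have h1 := hle (P.reflectionPerm θ i)
  have h2 := hle (P.reflectionPerm (P.reflectionPerm θ i) (P.reflectionPerm θ i))
  have h3 := b.height_reflectionPerm_self (P.reflectionPerm θ i)
  change b.height (P.reflectionPerm (P.reflectionPerm θ i) (P.reflectionPerm θ i)) = _ at h3
  have h4 := hle i
  have h5 : 0 < b.height i := hi
  rw [h3, hh] at h2
  rw [hh] at h1
  simp only [smul_eq_mul] at h1 h2
  constructor
  · by_contra! hlt
    nlinarith
  · intro hne
    by_contra! hlt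
    have h6 : b.height θ ≤ b.height i := by nlinarith
    exact hne ((le_height_of_mem_closure b (hθ.2 i trivial)).2 h6).symm

/-- A simple affine reflection maps positive affine roots of the form `[α, 0]` and `[-α, ħ]` other
than the corresponding simple affine root to positive ones. -/
theorem isAffinePos_simple [Finite ι] [P.IsRootSystem] [P.IsCrystallographic] [P.IsReduced]
    (b : P.Base) {θ : ι} (hθ : IsMaximalRoot P (b.support : Set ι) Set.univ θ) {η : ι → ℂ}
    {S : Set ι} {ħ : ℂ} {w : P.weylGroup} (hw : w ∈ weylPlus b S) (j : Option b.support)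
    {β : ι × ℤ} (hβ : β ∈ movedAffineSimple P η S ħ w) (hne : β ≠ affSimple b θ j) {n : ℤ}
    (hn : P.root' β.1 (((affSimple b θ j).2 : ℂ) • P.coroot (affSimple b θ j).1) = n) :
    IsAffinePos b (RootPairing.weylGroup.ofIdx P (affSimple b θ j).1 • β.1, β.2 - n) := by
  cases j with
  | some i =>
    simp only [affSimple, Int.cast_zero, zero_smul, map_zero] at hn hne ⊢
    have hn0 : n = 0 := by exact_mod_cast hn.symm
    subst hn0
    rcases hβ with ⟨a, ha, rfl⟩ | ⟨c, hc, rfl⟩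
    · right
      refine ⟨by simp, ?_⟩
      rw [ofIdx_smul_index]
      -- A simple reflection permutes the positive roots other than its own.
      exact (hw a ha).reflectionPerm i.2 fun h => hne (Prod.ext h rfl)
    · left
      simp
  | none =>
    have hco : P.coroot (P.reflectionPerm θ θ) = -P.coroot θ := by simp
    have hs (k : ι) : RootPairing.weylGroup.ofIdx P (P.reflectionPerm θ θ) • P.root k =
        P.root k - P.pairingIn ℤ k θ • P.root θ := by
      rw [ofIdx_smul_eq, hco, root_reflectionPerm_self, ← RootPairing.root', map_neg,
        RootPairing.root'_coroot_eq_pairing, neg_smul_neg, ← P.algebraMap_pairingIn ℤ,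
        ← Int.cast_smul_eq_zsmul ℂ]
      rfl
    simp only [affSimple, Int.cast_one, one_smul, hco, map_neg,
      RootPairing.root'_coroot_eq_pairing] at hn hne ⊢
    rw [← P.algebraMap_pairingIn ℤ] at hn
    have hn' : -P.pairingIn ℤ β.1 θ = n := by
      have : ((-P.pairingIn ℤ β.1 θ : ℤ) : ℂ) = n := by rw [← hn]; simp
      exact_mod_cast this
    -- The image of `[wa, 0]` has level `⟨wa, θ^∨⟩ ≥ 0`, and if this is 0 the root is fixed. The
    -- image of `[-wc, ħ]` has level `1 - ⟨wc, θ^∨⟩ ≥ 0`, and at level 0 its gradient is `θ - wc`,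
    -- which is positive by maximality of `θ`.
    rcases hβ with ⟨a, ha, rfl⟩ | ⟨c, hc, rfl⟩
    · have h1 := (pairing_maximalRoot b hθ (hw a ha)).1
      simp only at hn' ⊢
      rcases h1.lt_or_eq with h2 | h2
      · left
        simp only
        omega
      · right
        refine ⟨by simp only; omega, ?_⟩
        have h3 : RootPairing.weylGroup.ofIdx P (P.reflectionPerm θ θ) • w • a = w • a := by
          refine P.root.injective ?_
          rw [root_smul _ (w • a), hs, ← h2, zero_smul, sub_zero]
        rw [h3]
        exact hw a ha
    · have hcpos := isPos_smul_componentMaximalRoot b hw hc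
      have h1 := (pairing_maximalRoot b hθ hcpos).2 fun h => hne (by simp only [h])
      have h4 : P.pairingIn ℤ (P.reflectionPerm (w • c) (w • c)) θ = -P.pairingIn ℤ (w • c) θ := by
        simp
      simp only [h4, neg_neg] at hn' ⊢
      rcases h1.lt_or_eq with h2 | h2
      · left
        simp only
        omega
      · right
        refine ⟨by simp only; omega, ?_⟩
        rw [isPos_iff_mem_closure, root_smul, hs, root_reflectionPerm_self, h4, h2, neg_smul, one_smul,
          sub_neg_eq_add, neg_add_eq_sub]
        exact hθ.2 (w • c) trivial

/-! ### The group `Π` -/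

/-- The function `ψ` on `V` is a combination of affine simple roots with coefficients in `ℕ`,
as far as its gradient and its level are concerned. -/
def IsPosFunctional (b : P.Base) (ħ : ℂ) (ψ : V → ℂ) : Prop :=
  ∃ (N : ℕ) (m : M), (∀ x, ψ x = P.toLinearMap m x + ħ * N) ∧
    (N = 0 → m ∈ AddSubmonoid.closure (P.root '' (b.support : Set ι)))

theorem IsPosFunctional.add {b : P.Base} {ħ : ℂ} {ψ φ : V → ℂ} (hψ : IsPosFunctional b ħ ψ)
    (hφ : IsPosFunctional b ħ φ) : IsPosFunctional b ħ (ψ + φ) := by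
  obtain ⟨N, m, h1, h2⟩ := hψ
  obtain ⟨N', m', h1', h2'⟩ := hφ
  refine ⟨N + N', m + m', fun x => ?_, fun h => ?_⟩
  · rw [Pi.add_apply, h1, h1', map_add, LinearMap.add_apply]
    push_cast
    ring
  · exact add_mem (h2 (by omega)) (h2' (by omega))

/-- Evaluation at the origin recovers the level because `ħ ≠ 0`, and the perfect pairing then
recovers the gradient. -/
theorem isAffinePos_of_isPosFunctional [P.IsRootSystem] (b : P.Base) {ħ : ℂ} (hħ : ħ ≠ 0)
    {β : ι × ℤ} (h : IsPosFunctional b ħ (affRoot P ħ β)) : IsAffinePos b β := by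
  obtain ⟨N, m, h1, h2⟩ := h
  have h3 := h1 0
  rw [affRoot_apply, map_zero, map_zero, zero_add, zero_add] at h3
  have h4 : β.2 = N := by exact_mod_cast mul_left_cancel₀ hħ h3
  rcases Nat.eq_zero_or_pos N with h0 | h0
  · right
    refine ⟨by simp [h4, h0], ?_⟩
    rw [isPos_iff_mem_closure]
    have h5 : P.root β.1 = m := by
      refine P.toPerfPair.injective (LinearMap.ext fun x => ?_)
      have h6 := h1 x
      rw [affRoot_apply, h4] at h6
      push_cast at h6
      exact add_right_cancel h6
    rw [h5]
    exact h2 h0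
  · left
    rw [h4]
    exact_mod_cast h0

theorem isPosFunctional_affSimple (b : P.Base) (θ : ι) (ħ : ℂ) (j : Option b.support) :
    IsPosFunctional b ħ (affRoot P ħ (affSimple b θ j)) := by
  cases j with
  | none => exact ⟨1, P.root (P.reflectionPerm θ θ), fun x => by rw [affRoot_apply, Nat.cast_one]; simp only [affSimple, Int.cast_one], fun h => absurd h one_ne_zero⟩
  | some i =>
    exact ⟨0, P.root i, fun x => by rw [affRoot_apply]; simp [affSimple],
      fun _ => AddSubmonoid.subset_closure (Set.mem_image_of_mem _ i.2)⟩

/-- Each affine simple root of `wR₀` is a non-negative combination of the affine simple roots of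
`R`, which `g` permutes. Positivity is thus preserved, with no exceptional root as there is for a
simple reflection. -/
theorem isAffinePos_piGroup [P.IsRootSystem] (b : P.Base) {θ : ι}
    (hθ : IsMaximalRoot P (b.support : Set ι) Set.univ θ) {η : ι → ℂ}
    {S : Set ι} {ħ : ℂ} (hħ : ħ ≠ 0) {w : P.weylGroup} (hw : w ∈ weylPlus b S)
    {g : V ≃ᵃ[ℂ] V} (hgpi : g ∈ piGroup b θ ħ) {u : P.weylGroup} {μ : V}
    (hg : IsAffineWeyl P ħ g u μ)
    {β : ι × ℤ} (hβ : β ∈ movedAffineSimple P η S ħ w) {n : ℤ} (hn : P.root' β.1 μ = n) :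
    IsAffinePos b (u • β.1, β.2 - n) := by
  have hsimple (j : Option b.support) :
      IsPosFunctional b ħ (fun y => affRoot P ħ (affSimple b θ j) (g⁻¹ y)) := by
    have h : actFunctional g (affRoot P ħ (affSimple b θ j)) ∈ affSimpleSet b θ ħ := by
      rw [← hgpi.2]
      exact Set.mem_image_of_mem _ ⟨j, rfl⟩
    obtain ⟨k, hk⟩ := h
    have h2 := isPosFunctional_affSimple b θ ħ k
    simp only at hk
    rw [hk] at h2
    exact h2
  have hclosure : ∀ m ∈ AddSubmonoid.closure (P.root '' (b.support : Set ι)),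
      IsPosFunctional b ħ (fun y => P.toLinearMap m (g⁻¹ y)) := by
    intro m hm
    induction hm using AddSubmonoid.closure_induction with
    | mem x hx =>
      obtain ⟨i, hi, rfl⟩ := hx
      have h := hsimple (some ⟨i, hi⟩)
      simp only [affRoot_apply, affSimple, Int.cast_zero, mul_zero, add_zero] at h
      exact h
    | zero => exact ⟨0, 0, fun x => by simp, fun _ => zero_mem _⟩
    | add x y _ _ hx hy =>
      have h := hx.add hy
      convert h using 1
      ext z
      rw [map_add, LinearMap.add_apply, Pi.add_apply]
  have hβpos : IsPosFunctional b ħ (fun y => affRoot P ħ β (g⁻¹ y)) := by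
    rcases hβ with ⟨a, ha, rfl⟩ | ⟨c, hc, rfl⟩
    · have h := hclosure _ ((isPos_iff_mem_closure b _).1 (hw a ha))
      simp only [affRoot_apply, Int.cast_zero, mul_zero, add_zero]
      exact h
    -- The decomposition `[-wc, ħ] = α₀ + (θ - wc)`, whose second summand lies in the positive cone.
    · have h := (hsimple none).add (hclosure _ (hθ.2 (w • c) trivial))
      convert h using 1
      ext y
      rw [Pi.add_apply, affRoot_apply, affRoot_apply]
      simp only [affSimple, RootPairing.root', root_reflectionPerm_self, map_neg, map_sub,
        LinearMap.neg_apply, LinearMap.sub_apply]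
      ring
  refine isAffinePos_of_isPosFunctional b hħ ?_
  -- In normal form, `β ∘ g⁻¹` has gradient `u β` and its level is lowered by the pairing `n` with
  -- `μ`.
  convert hβpos using 1
  ext y
  obtain ⟨x, rfl⟩ := g.surjective y
  have h1 : g⁻¹ (g x) = x := g.symm_apply_apply x
  rw [h1, affRoot_apply, affRoot_apply, RootPairing.root', root_smul, hg.2, map_add,
    LinearMap.map_smul, ← RootPairing.root', hn, smul_eq_mul]
  push_cast
  ring

end Operators
-- Invariance of the ideal under the generators
section Invariance

variable {ι M V : Type*} [AddCommGroup M] [Module ℂ M]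
  [NormedAddCommGroup V] [NormedSpace ℂ V] {P : RootPairing ι ℂ M V}

/-- The operators that map the ideal of functions vanishing on `D` to itself. -/
def stabilizerSubalgebra (P : RootPairing ι ℂ M V) (D : Set V) :
    Subalgebra ℂ (Module.End ℂ (periodicFunctions P)) where
  carrier := {A | ∀ f ∈ vanishingIdeal P D, A f ∈ vanishingIdeal P D}
  mul_mem' hA hB _ hf := hA _ (hB _ hf)
  add_mem' hA hB f hf := add_mem (hA f hf) (hB f hf)
  algebraMap_mem' c _ hf x hx := mul_eq_zero_of_right c (hf x hx)

/-- Either `α_j` is an affine simple root of `wR₀` and the coefficient of the divided difference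
vanishes on the plane, or `s_j` moves the plane into the arrangement. In the second case `α_j` is
non-constant on the plane, so the continuity argument applies. -/
theorem opT_mem_stabilizerSubalgebra [Finite ι] [FiniteDimensional ℂ V] [P.IsRootSystem]
    [P.IsCrystallographic] [P.IsReduced] (b : P.Base) {θ : ι}
    (hθ : IsMaximalRoot P (b.support : Set ι) Set.univ θ) {ħ : ℂ} {t : ι × ℤ → ℂˣ}
    (ht : ∀ w ∈ extAffineWeylGroup P ħ, ∀ β γ : ι × ℤ,
      affRoot P ħ γ = actFunctional w (affRoot P ħ β) → t γ = t β)
    {η : ι → ℂ} (hη : ∀ (w : P.weylGroup) (i : ι), η (w • i) = η i)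
    {S : Set ι} (hS : S ⊆ b.support)
    (hcox : ∀ C : Set ι, IsIrreducibleComponent P (spannedRoots P S) C →
      IsGenCoxeterNumber P η (S ∩ C) C ħ)
    (htη : ∀ i : ι, (t (i, 0) : ℂ) ^ 2 = Complex.exp (η i)) (j : Option b.support) :
    opT P ħ (affSimple b θ j) (t (affSimple b θ j)) ∈
      stabilizerSubalgebra P (arrangement b η S) := by
  intro f hf x hxD
  obtain ⟨w, hw, hx⟩ := Set.mem_iUnion₂.1 hxD
  by_cases hj : affSimple b θ j ∈ movedAffineSimple P η S ħ w
  · refine opT_apply_eq_zero_of_affRoot_eq ħ _ _ f ?_ (hf x hxD)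
    rw [affRoot_eq_of_mem_movedAffineSimple hη hj hx, ← htη, ← eq_of_translation_invariant b ht _
      (affSimple b θ j).2]
  · refine opT_apply_eq_zero_of_notMem_span ħ _ _ f
      (fun h => hj (affSimple_mem_movedAffineSimple b hθ hS hcox hw j h)) (fun y hy => ⟨?_, ?_⟩) hx
    · exact hf y (Set.mem_iUnion₂.2 ⟨w, hw, hy⟩)
    · exact hf _ (apply_mem_arrangement b hη hS hcox (isAffineWeyl_affRefl ħ (affSimple b θ j)) w
        (fun β hβ n hn => isAffinePos_simple b hθ hw j hβ (fun h => hj (h ▸ hβ)) hn) hy)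

theorem opW_mem_stabilizerSubalgebra [Finite ι] [FiniteDimensional ℂ V] [P.IsRootSystem]
    (b : P.Base) {θ : ι} (hθ : IsMaximalRoot P (b.support : Set ι) Set.univ θ) {ħ : ℂ} (hħ : ħ ≠ 0)
    {η : ι → ℂ} (hη : ∀ (w : P.weylGroup) (i : ι), η (w • i) = η i)
    {S : Set ι} (hS : S ⊆ b.support)
    (hcox : ∀ C : Set ι, IsIrreducibleComponent P (spannedRoots P S) C →
      IsGenCoxeterNumber P η (S ∩ C) C ħ) (r : piGroup b θ ħ) :
    opW P ħ ⟨r.1, r.2.1⟩ ∈ stabilizerSubalgebra P (arrangement b η S) := by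
  intro f hf x hxD
  obtain ⟨w, hw, hx⟩ := Set.mem_iUnion₂.1 hxD
  -- The operator composes functions with the inverse, so it is `r⁻¹` that has to move the plane
  -- into the arrangement.
  obtain ⟨u, μ, hg⟩ := exists_isAffineWeyl (r⁻¹).2.1
  exact hf _ (apply_mem_arrangement b hη hS hcox hg w
    (fun β hβ n hn => isAffinePos_piGroup b hθ hħ hw (r⁻¹).2 hg hβ hn) hx)

end Invariance
end DAHA

theorem mainTheorem1 {ι M V : Type*} [Finite ι] [AddCommGroup M] [Module ℂ M]
    [NormedAddCommGroup V] [NormedSpace ℂ V] [FiniteDimensional ℂ V]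
    (P : RootPairing ι ℂ M V) [P.IsRootSystem] [P.IsCrystallographic] [P.IsReduced]
    [P.IsIrreducible] (b : P.Base)
    (θ : ι) (hθ : IsMaximalRoot P (b.support : Set ι) Set.univ θ)
    (ħ : ℂ) (hħ : ∀ r : ℚ, ħ ≠ Real.pi * Complex.I * (r : ℂ))
    (ε₀ : ℤ) (hε₀ : ε₀ ≠ 0)
    (hε : ∀ μ ∈ weightLattice P, ∀ l ∈ coweightLattice P, ∃ n : ℤ, (ε₀ : ℂ) * μ l = n)
    (t : ι × ℤ → ℂˣ)
    (ht : ∀ w ∈ extAffineWeylGroup P ħ, ∀ β γ : ι × ℤ,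
      affRoot P ħ γ = actFunctional w (affRoot P ħ β) → t γ = t β)
    (η : ι → ℂ) (hη : ∀ (w : P.weylGroup) (i : ι), η (w • i) = η i)
    (S₀ : Set ι) (hS₀ : S₀ ⊆ b.support)
    (hcox : ∀ C : Set ι, IsIrreducibleComponent P (spannedRoots P S₀) C →
      IsGenCoxeterNumber P η (S₀ ∩ C) C ħ)
    (htη : ∀ i : ι, (t (i, 0) : ℂ) ^ 2 = Complex.exp (η i)) :
    (∀ A ∈ Algebra.adjoin ℂ (Set.range (genOp b θ ħ ε₀ t)),
      ∀ f ∈ vanishingIdeal P (arrangement b η S₀), A f ∈ vanishingIdeal P (arrangement b η S₀)) ∧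
    (∀ ρ : DoubleAffineHeckeAlgebra b θ ħ ε₀ t →ₐ[ℂ] Module.End ℂ (periodicFunctions P),
      (∀ g, ρ (genElem b θ ħ ε₀ t g) = genOp b θ ħ ε₀ t g) →
      ∀ a, ∀ f ∈ vanishingIdeal P (arrangement b η S₀),
        ρ a f ∈ vanishingIdeal P (arrangement b η S₀)) := by
  have hħ0 : ħ ≠ 0 := by simpa using hħ 0
  have hgen : ∀ g : Gen b θ ħ ε₀, genOp b θ ħ ε₀ t g ∈ stabilizerSubalgebra P (arrangement b η S₀) := by
    rintro (j | μ | r)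
    · exact opT_mem_stabilizerSubalgebra b hθ ht hη hS₀ hcox htη j
    · exact fun f hf x hx => mul_eq_zero_of_right _ (hf x hx)
    · exact opW_mem_stabilizerSubalgebra b hθ hħ0 hη hS₀ hcox r
  refine ⟨fun A hA => Algebra.adjoin_le (Set.range_subset_iff.2 hgen) hA, fun ρ hρ a => ?_⟩
  obtain ⟨a, rfl⟩ := RingQuot.mkAlgHom_surjective ℂ (Rel b θ ħ ε₀ t) a
  -- The preimage of the stabilizer in the free algebra is a subalgebra containing the free
  -- generators, hence everything.
  have h : (⊤ : Subalgebra ℂ (FreeAlgebra ℂ (Gen b θ ħ ε₀))) ≤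
      (stabilizerSubalgebra P (arrangement b η S₀)).comap
        (ρ.comp (RingQuot.mkAlgHom ℂ (Rel b θ ħ ε₀ t))) := by
    rw [← FreeAlgebra.adjoin_range_ι]
    refine Algebra.adjoin_le (Set.range_subset_iff.2 fun g => ?_)
    have h := hgen g
    rw [← hρ] at h
    exact h
  exact h (Algebra.mem_top (x := a))
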